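/- Let $K=\mathbb{Q}(\sqrt{-3})$ with ring of integers $\mathcal{O}_K$ and complex conjugation $\alpha\mapsto\bar\alpha$. Let $k$ be a nonzero integer, let $E/\mathbb{Q}$ be the elliptic curve $E:y^2=x^3+k$, which has complex multiplication by $\mathcal{O}_K$, and let $\psi_E$ be the Grössencharacter of $E$ over $K$. For a prime ideal $\mathfrak{p}$ of $\mathcal{O}_K$ at which $E$ has good reduction, the value $\psi_E(\mathfrak{p})$ is the unique generator of $\mathfrak{p}$ such that $\#\tilde E_{\mathfrak{p}}(\mathbb{F}_{\mathfrak{p}})=\mathrm{N}_{K/\mathbb{Q}}(\mathfrak{p})+1-\mathrm{Tr}_{K/\mathbb{Q}}(\psi_E(\mathfrak{p}))$. For a prime ideal $\mathfrak{p}$ of $\mathcal{O}_K$ not dividing $6$ and $\alpha\in\mathcal{O}_K\setminus\mathfrak{p}$, let the sextic residue symbol $\left(\frac{\alpha}{\mathfrak{p}}\right)_6$ be the unique sixth root of unity in $K$ that is congruent to $\alpha^{(\mathrm{N}_{K/\mathbb{Q}}(\mathfrak{p})-1)/6}$ modulo $\mathfrak{p}$. Suppose that $p\ge5$ and $q\ge5$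 are primes of good reduction for $E$ such that $\#\tilde E_p(\mathbb{F}_p)=q$. Then: (a) The prime $p$ splits in $K$, i.e. $p\mathcal{O}_K=\mathfrak{p}\bar{\mathfrak{p}}$ with a prime ideal $\mathfrak{p}\ne\bar{\mathfrak{p}}$, and for either choice of $\mathfrak{p}$, $$\psi_E(\mathfrak{p})\bigl(1-\psi_E(\mathfrak{p})\bigr)\equiv 1\pmod{3\mathcal{O}_K}.$$ (b) The ideal $\mathfrak{q}=\bigl(1-\psi_E(\mathfrak{p})\bigr)\mathcal{O}_K$ satisfies $q\mathcal{O}_K=\mathfrak{q}\bar{\mathfrak{q}}$, and the prime $q$ splits in $K$: $\mathfrak{q}$ is a prime ideal and $\mathfrak{q}\ne\bar{\mathfrak{q}}$. Suppose moreover that $p\nmid k$ and $q\nmid k$ (so that the following residue symbols are defined). Then: (c) $$1-\psi_E(\mathfrak{p})=\left(\frac{4k}{\mathfrak{p}}\right)_6\left(\frac{4k}{\mathfrak{q}}\right)_6\psi_E(\mathfrak{q}).$$ (d) For each $\epsilon\in\{1,-1\}$, the trace $a_q(E)=q+1-\#\tilde E_q(\mathbb{F}_q)$ satisfies $$a_q(E)=\epsilon(q+1-p)\quad\Longleftrightarrow\quad\left(\frac{4k}{\mathfrak{p}}\right)_6\left(\frac{4k}{\mathfrak{q}}\right)_6=\epsilon.$$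 -/

import Mathlib

open NumberField IsDedekindDomain

namespace SexticCM

/-! ### Reduction of elliptic curves over fraction fields of discrete valuation rings -/

section Reduction

variable (R : Type*) [CommRing R] [IsDomain R] [IsDiscreteValuationRing R]
  {F : Type*} [Field F] [Algebra R F] [IsFractionRing R F]

/-- The elliptic curve `W` over `F = Frac R` has good reduction: a minimal Weierstrass equation
of `W` has unit discriminant. -/
def HasGoodReductionAt (W : WeierstrassCurve F) : Prop :=
  (W.minimal R).HasGoodReduction R

/-- The number of points, over the residue field of `R`, of the reduction of a minimal
Weierstrass equation of `W`. -/
noncomputable def numReductionPoints (W : WeierstrassCurve F) : ℕ :=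
  Nat.card ((W.minimal R).reduction R).toAffine.Point

end Reduction

/-! ### The curve `E : y² = x³ + k` over `ℚ` and its reduction at rational primes -/

/-- The curve `E : y² = x³ + k` over `ℚ`. -/
def curve (k : ℤ) : WeierstrassCurve ℚ := ⟨0, 0, 0, 0, (k : ℚ)⟩

/-- `E` has good reduction at the rational prime `p`. -/
def GoodPrime (k : ℤ) (p : ℕ) [Fact p.Prime] : Prop :=
  HasGoodReductionAt ℤ_[p] ((curve k).baseChange ℚ_[p])

/-- The number of points `#Ẽ_p(𝔽_p)`. -/
noncomputable def numPoints (k : ℤ) (p : ℕ) [Fact p.Prime] : ℕ :=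
  numReductionPoints ℤ_[p] ((curve k).baseChange ℚ_[p])

/-- The trace of Frobenius `a_p(E) = p + 1 - #Ẽ_p(𝔽_p)`. -/
noncomputable def frobeniusTrace (k : ℤ) (p : ℕ) [Fact p.Prime] : ℤ :=
  (p : ℤ) + 1 - (numPoints k p : ℤ)

/-! ### The field `K = ℚ(√-3)`

The field `K = ℚ(√-3)` is taken as a number field generated over `ℚ` by a primitive cube root of
unity `ζ`; here `√-3 = 2ζ + 1`. -/

section Field

variable {K : Type*} [Field K] [NumberField K] [IsCyclotomicExtension {3} ℚ K]

/-- The complex conjugate of an ideal of `𝓞 K`. -/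
noncomputable def conjIdeal (I : Ideal (𝓞 K)) : Ideal (𝓞 K) :=
  haveI : IsCMField K :=
    IsCyclotomicExtension.Rat.isCMField K (S := {3}) ⟨3, rfl, by norm_num⟩
  I.map (IsCMField.ringOfIntegersComplexConj K)

open Classical in
/-- The sextic residue symbol `(α / 𝔭)₆`, for a prime ideal `𝔭` not dividing `6` and `α ∉ 𝔭`: the
unique sixth root of unity `ζ` with `ζ ≡ α ^ ((N𝔭 - 1) / 6) (mod 𝔭)`.
(It is `0` where there is no such `ζ`.) -/
noncomputable def sexticSymbol (α : 𝓞 K) (𝔭 : Ideal (𝓞 K)) : 𝓞 K :=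
  if h : ∃ ζ : 𝓞 K, ζ ^ 6 = 1 ∧ ζ - α ^ ((Ideal.absNorm 𝔭 - 1) / 6) ∈ 𝔭 then h.choose else 0

/-! ### The Grössencharacter of `E` over `K` -/

/-- The defining property of the value `α = ψ_E(𝔭)` of the Grössencharacter at a prime ideal `𝔭` at
which `E` has good reduction: `α` generates `𝔭`, and `#Ẽ_𝔭(𝔽_𝔭) = N𝔭 + 1 - Tr_{K/ℚ}(α)`,
where the reduction is taken with respect to the local ring of `K` at `𝔭`.
These two conditions determine `α`: distinct generators of `𝔭` have distinct traces if `𝔭` has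
degree one and does not divide `3`; if `𝔭 = (ℓ)` with `ℓ` an inert rational prime, then
`α = -ℓ` is the only generator with trace `-2 ℓ`; and `E` has bad reduction at `(√-3)`. -/
def IsGrossencharacterValue (k : ℤ) (v : HeightOneSpectrum (𝓞 K)) (α : 𝓞 K) : Prop :=
  HasGoodReductionAt (v.valuation K).valuationSubring ((curve k).baseChange K) ∧
  Ideal.span {α} = v.asIdeal ∧
  (numReductionPoints (v.valuation K).valuationSubring ((curve k).baseChange K) : ℤ) =
    (Ideal.absNorm v.asIdeal : ℤ) + 1 - Algebra.trace ℤ (𝓞 K) α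

open Classical in
/-- The value `ψ_E(𝔭)` at a prime ideal `𝔭`, with the usual convention `ψ_E(𝔭) = 0` if `E` has bad
reduction at `𝔭`. -/
noncomputable def grossencharacterAtPrime (k : ℤ) (v : HeightOneSpectrum (𝓞 K)) : 𝓞 K :=
  if h : ∃ α : 𝓞 K, IsGrossencharacterValue k v α then h.choose else 0

open Classical in
/-- The Grössencharacter `ψ_E` of `E` over `K`, as a function on ideals: it is the multiplicative
extension `𝔞 = ∏ 𝔭ᵢ ↦ ∏ ψ_E(𝔭ᵢ)` of its values at the prime ideals. (It is `0` at the zero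
ideal.) -/
noncomputable def grossencharacter (k : ℤ) (I : Ideal (𝓞 K)) : 𝓞 K :=
  if I = ⊥ then 0 else
    ((UniqueFactorizationMonoid.normalizedFactors I).map fun 𝔭 =>
      if h : 𝔭.IsPrime ∧ 𝔭 ≠ ⊥ then grossencharacterAtPrime k ⟨𝔭, h.1, h.2⟩ else 0).prod

end Field

end SexticCM

namespace SexticCM

/-! ### Point counts of Weierstrass curves over finite fields -/

section PointCount

variable {L : Type*} [Field L]

/-! Write ψ = ψ_E(𝔭), φ = ψ_E(𝔮), S = (4k/𝔭)₆ and T = (4k/𝔮)₆. Everything rests on the congruence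
ψ·S ≡ 1 (mod 3). The number of points on y² = x³ + c over a field with p ≡ 1 (mod 3) elements is a
sum of two conjugate Jacobi sum terms (`mordellCount_eq_jacobiSum`). The cubic Jacobi sum J lies in
𝔭 (`jacobiSum_mem`), has norm p (`jacobiSum_mul_conj`) and is ≡ -1 (mod 3), so J times an explicit
root of unity is ψ (`exists_generator_mordellCount`, `grossencharacter_spec`).

Since N(1 - ψ) = p + 1 - Tr ψ = q is prime to 3, the sixth root of unity congruent to ψ modulo 3 is
not a cube root of unity. The remaining ones all satisfy r(1 - r) ≡ 1, which gives (a)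
(`mul_one_sub_congr_one`). For (c), 1 - ψ and φ generate the same ideal, and the congruences ψ(1 -
ψ) ≡ ψS ≡ φT ≡ 1 force their ratio to be ≡ ST. Units of 𝓞 K are determined modulo 3
(`eq_one_of_isUnit_of_sub_one_mem`). Part (d) follows because a generator of 𝔮 is determined by its
trace (`generator_eq_of_trace_eq`).

Reductions are defined through a chosen minimal model. Away from 6 any model with unit discriminant
gives the same count (`numReductionPoints_of_unit_model`), and good reduction at p makes v_p(k)
divisible by 6 (`exists_sixth_power_factor`), so y² = x³ + k' with p ∤ k' serves as such a model. -/

theorem equation_variableChange_iff (C : WeierstrassCurve.VariableChange L)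
    (W : WeierstrassCurve L) (x y : L) :
    (C • W).toAffine.Equation x y ↔
      W.toAffine.Equation (C.u ^ 2 * x + C.r) (C.u ^ 3 * y + C.u ^ 2 * C.s * x + C.t) := by
  have hu : (C.u : L) ≠ 0 := C.u.ne_zero
  rw [WeierstrassCurve.Affine.equation_iff', WeierstrassCurve.Affine.equation_iff',
    ← mul_eq_zero_iff_left (pow_ne_zero 6 hu)]
  simp only [WeierstrassCurve.variableChange_a₁, WeierstrassCurve.variableChange_a₂,
    WeierstrassCurve.variableChange_a₃, WeierstrassCurve.variableChange_a₄,
    WeierstrassCurve.variableChange_a₆, Units.val_inv_eq_inv_val]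
  refine Eq.congr_left ?_
  field_simp
  ring

theorem card_equation_variableChange (C : WeierstrassCurve.VariableChange L)
    (W : WeierstrassCurve L) :
    Nat.card {P : L × L // (C • W).toAffine.Equation P.1 P.2} =
      Nat.card {P : L × L // W.toAffine.Equation P.1 P.2} := by
  have hu : (C.u : L) ≠ 0 := C.u.ne_zero
  let e : L × L ≃ L × L :=
    { toFun := fun P => (C.u ^ 2 * P.1 + C.r, C.u ^ 3 * P.2 + C.u ^ 2 * C.s * P.1 + C.t)
      invFun := fun P => ((C.u ^ 2 : L)⁻¹ * (P.1 - C.r),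
        (C.u ^ 3 : L)⁻¹ * (P.2 - C.t - C.s * (P.1 - C.r)))
      left_inv := fun P => by
        ext
        · simp only; field_simp; ring
        · simp only; field_simp; ring
      right_inv := fun P => by
        ext
        · simp only; field_simp; ring
        · simp only; field_simp; ring }
  exact Nat.card_congr (e.subtypeEquiv fun P => equation_variableChange_iff C W P.1 P.2)

theorem card_affinePoint [Finite L] (W : WeierstrassCurve L) (hΔ : W.Δ ≠ 0) :
    Nat.card W.toAffine.Point = Nat.card {P : L × L // W.toAffine.Equation P.1 P.2} + 1 := by
  rw [← Finite.card_option]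
  refine Nat.card_congr
    { toFun := fun P => match P with
        | .zero => none
        | .some x y h => some ⟨(x, y), h.1⟩
      invFun := fun P => match P with
        | none => .zero
        | some ⟨(x, y), h⟩ => .some x y
          ((WeierstrassCurve.Affine.equation_iff_nonsingular_of_Δ_ne_zero (W := W) hΔ).1 h)
      left_inv := fun P => by rcases P with _ | _ <;> rfl
      right_inv := fun P => by rcases P with _ | ⟨⟨x, y⟩, h⟩ <;> rfl }

/-- The number of affine points `(x, y)` on `y² = x³ + c` over the field `L`. -/
noncomputable def mordellCount (L : Type*) [Field L] (c : L) : ℕ :=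
  Nat.card {P : L × L // P.2 ^ 2 = P.1 ^ 3 + c}

theorem mordellCount_congr {L' : Type*} [Field L'] (e : L ≃+* L') (c : L) :
    mordellCount L c = mordellCount L' (e c) := by
  refine Nat.card_congr ((e.toEquiv.prodCongr e.toEquiv).subtypeEquiv fun P => ?_)
  simp only [RingEquiv.toEquiv_eq_coe, Equiv.prodCongr_apply, EquivLike.coe_coe, Prod.map_fst,
    Prod.map_snd]
  rw [← map_pow, ← map_pow, ← map_add, e.injective.eq_iff]

/-- Fields of prime order p are isomorphic, and isomorphisms fix images of integers. This transports
counts between the various residue fields and `ZMod p`. -/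
theorem mordellCount_intCast {L' : Type*} [Field L'] {p : ℕ} [Fact p.Prime]
    (hL : Nat.card L = p) (hL' : Nat.card L' = p) (c : ℤ) :
    mordellCount L (c : L) = mordellCount L' (c : L') := by
  have h0 : p ≠ 0 := (Fact.out : p.Prime).ne_zero
  have : Finite L := Nat.finite_of_card_ne_zero (by omega)
  have : Finite L' := Nat.finite_of_card_ne_zero (by omega)
  have := Fintype.ofFinite L
  have := Fintype.ofFinite L'
  rw [Nat.card_eq_fintype_card] at hL hL'
  let e := (ZMod.ringEquivOfPrime L Fact.out hL).symm.trans
    (ZMod.ringEquivOfPrime L' Fact.out hL')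
  rw [mordellCount_congr e, map_intCast]

end PointCount

/-! ### Minimal models in residue characteristic prime to `6` -/

section GoodModel

open WeierstrassCurve

variable {R : Type*} [CommRing R] [IsDomain R] [IsDiscreteValuationRing R]
  {F : Type*} [Field F] [Algebra R F] [IsFractionRing R F]

theorem exists_unit_of_valuation_eq_one (x : F)
    (hx : HeightOneSpectrum.valuation F (IsDiscreteValuationRing.maximalIdeal R) x = 1) :
    ∃ r : Rˣ, algebraMap R F r = x := by
  obtain ⟨r, hr⟩ := IsDiscreteValuationRing.exists_lift_of_le_one hx.le
  obtain ⟨s, hs⟩ := IsDiscreteValuationRing.exists_lift_of_le_one (A := R) (K := F) (x := x⁻¹)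
    (by rw [map_inv₀, hx, inv_one])
  have hx0 : x ≠ 0 := by rintro rfl; simp at hx
  have hrs : r * s = 1 := by
    apply IsFractionRing.injective R F
    rw [map_mul, hr, hs, map_one, mul_inv_cancel₀ hx0]
  exact ⟨Units.mkOfMulEqOne r s hrs, hr⟩

theorem valuation_unit (r : R) (hr : IsUnit r) :
    HeightOneSpectrum.valuation F (IsDiscreteValuationRing.maximalIdeal R) (algebraMap R F r)
      = 1 := by
  refine le_antisymm (HeightOneSpectrum.valuation_le_one _ r) (not_lt.1 fun h => ?_)
  rw [HeightOneSpectrum.valuation_lt_one_iff_mem] at h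
  exact (IsLocalRing.mem_maximalIdeal _).1 h hr

/-- A variable change between integral models with unit discriminants is integral, in residue
characteristic prime to `6`. -/
theorem exists_integral_variableChange (h6 : IsUnit (6 : R)) (W W' : WeierstrassCurve R)
    (hW : IsUnit W.Δ) (hW' : IsUnit W'.Δ) (C : VariableChange F)
    (hC : C • W.map (algebraMap R F) = W'.map (algebraMap R F)) :
    ∃ D : VariableChange R, D • W = W' := by
  set f := algebraMap R F
  have hf : Function.Injective f := IsFractionRing.injective R F
  have hu : (C.u : F) ≠ 0 := C.u.ne_zero
  -- The two discriminants differ by u¹², so u has valuation 1.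
  obtain ⟨u, hu'⟩ : ∃ u : Rˣ, f u = C.u := by
    apply exists_unit_of_valuation_eq_one
    have h := congrArg WeierstrassCurve.Δ hC
    rw [variableChange_Δ, map_Δ, map_Δ] at h
    have h2 := congrArg
      (HeightOneSpectrum.valuation F (IsDiscreteValuationRing.maximalIdeal R)) h
    rw [map_mul, valuation_unit _ hW, valuation_unit _ hW', mul_one, map_pow,
      Units.val_inv_eq_inv_val, map_inv₀, inv_pow, inv_eq_one] at h2
    exact (pow_eq_one_iff_of_nonneg zero_le (by norm_num)).1 h2
  have h2 : IsUnit (2 : R) := isUnit_of_dvd_unit ⟨3, by norm_num⟩ h6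
  have h12 : IsUnit (12 : R) := by
    rw [show (12 : R) = 2 * 6 by norm_num]; exact h2.mul h6
  obtain ⟨i2, hi2⟩ := h2.exists_right_inv
  obtain ⟨i12, hi12⟩ := h12.exists_right_inv
  have ha1 := congrArg WeierstrassCurve.a₁ hC
  have ha3 := congrArg WeierstrassCurve.a₃ hC
  have hb2 := congrArg WeierstrassCurve.b₂ hC
  rw [variableChange_a₁, map_a₁, map_a₁, Units.val_inv_eq_inv_val, inv_mul_eq_iff_eq_mul₀ hu] at ha1
  rw [variableChange_a₃, map_a₃, map_a₃, Units.val_inv_eq_inv_val, inv_pow,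
    inv_mul_eq_iff_eq_mul₀ (pow_ne_zero _ hu), map_a₁] at ha3
  rw [variableChange_b₂, map_b₂, map_b₂, Units.val_inv_eq_inv_val, inv_pow,
    inv_mul_eq_iff_eq_mul₀ (pow_ne_zero _ hu)] at hb2
  have hi2' : (2 : F) * f i2 = 1 := by rw [← map_ofNat f 2, ← map_mul, hi2, map_one]
  have hi12' : (12 : F) * f i12 = 1 := by rw [← map_ofNat f 12, ← map_mul, hi12, map_one]
  -- The laws u·a₁' = a₁ + 2s, u²·b₂' = b₂ + 12r and u³·a₃' = a₃ + r·a₁ + 2t are solved for r, s, t;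
  -- using b₂ in place of a₂ keeps s out of the equation for r.
  let r := (u ^ 2 * W'.b₂ - W.b₂) * i12
  have hr : f r = C.r := by
    simp only [r, map_mul, map_sub, map_pow, hu']
    linear_combination f i12 * (-hb2) + C.r * hi12'
  let s := (u * W'.a₁ - W.a₁) * i2
  have hs : f s = C.s := by
    simp only [s, map_mul, map_sub, hu']
    linear_combination f i2 * (-ha1) + C.s * hi2'
  let t := (u ^ 3 * W'.a₃ - W.a₃ - r * W.a₁) * i2
  have ht : f t = C.t := by
    simp only [t, map_mul, map_sub, map_pow, hu', hr]
    linear_combination f i2 * (-ha3) + C.t * hi2'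
  refine ⟨⟨u, r, s, t⟩, map_injective hf ?_⟩
  change (_ : WeierstrassCurve R).map f = W'.map f
  rw [← hC, ← map_variableChange]
  congr 1
  ext
  · simpa [VariableChange.map] using hu'
  · simpa [VariableChange.map] using hr
  · simpa [VariableChange.map] using hs
  · simpa [VariableChange.map] using ht

theorem hasGoodReduction_minimal_of_unit_model (W : WeierstrassCurve F) (W₀ : WeierstrassCurve R)
    (hW₀ : IsUnit W₀.Δ) (C : VariableChange F) (hC : C • W = W₀.map (algebraMap R F)) :
    HasGoodReductionAt R W := by
  have hmin : IsMinimal R (W.minimal R) := inferInstance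
  refine { goodReduction := ?_ }
  set D := (W.exists_isMinimal R).choose
  have hD : W.minimal R = D • W := rfl
  have key : (C * D⁻¹) • W.minimal R = W₀.map (algebraMap R F) := by
    rw [hD, mul_smul, inv_smul_smul, hC]
  have hint : IsIntegral R ((C * D⁻¹) • W.minimal R) := ⟨⟨W₀, key⟩⟩
  have hΔ := valuation_Δ_aux_eq_of_isIntegral R ((C * D⁻¹) • W.minimal R)
  rw [key, map_Δ, valuation_unit _ hW₀, ← key] at hΔ
  -- The unit model attains the largest possible discriminant valuation, so the minimal model must
  -- attain it too.
  have hle : (⟨1, le_rfl⟩ : { v : WithZero (Multiplicative ℤ) // v ≤ 1 }) ≤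
      valuation_Δ_aux R ((C * D⁻¹) • W.minimal R) := by
    rw [← Subtype.coe_le_coe, hΔ]
  have h1 := hmin.val_Δ_maximal.2 hint
  simp only [one_smul] at h1
  have h3 : (1 : WithZero (Multiplicative ℤ)) ≤ (valuation_Δ_aux R (W.minimal R)).1 :=
    le_trans hle (h1 (le_trans (valuation_Δ_aux R (W.minimal R)).2 hle))
  rw [valuation_Δ_aux_eq_of_isIntegral] at h3
  refine le_antisymm ?_ h3
  rw [← valuation_Δ_aux_eq_of_isIntegral R]
  exact (valuation_Δ_aux R (W.minimal R)).2

/-- The minimal model also has unit discriminant, so it differs from `W₀` by an integral change of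
variables, which reduces to the residue field. The extra 1 is the point at infinity. -/
theorem numReductionPoints_of_unit_model (h6 : IsUnit (6 : R))
    [Finite (IsLocalRing.ResidueField R)] (W : WeierstrassCurve F) (W₀ : WeierstrassCurve R)
    (hW₀ : IsUnit W₀.Δ) (C : VariableChange F) (hC : C • W = W₀.map (algebraMap R F)) :
    numReductionPoints R W =
      Nat.card {P : IsLocalRing.ResidueField R × IsLocalRing.ResidueField R //
        (W₀.map (IsLocalRing.residue R)).toAffine.Equation P.1 P.2} + 1 := by
  have hgood : (W.minimal R).HasGoodReduction R := hasGoodReduction_minimal_of_unit_model W W₀ hW₀ C hC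
  set D := (W.exists_isMinimal R).choose
  have hD : W.minimal R = D • W := rfl
  have key : (D * C⁻¹) • W₀.map (algebraMap R F) =
      (integralModel R (W.minimal R)).map (algebraMap R F) := by
    rw [← hC, mul_smul, inv_smul_smul, ← hD]
    exact (baseChange_integralModel_eq R (W.minimal R)).symm
  have hΔ : IsUnit (integralModel R (W.minimal R)).Δ := by
    have h := hgood.goodReduction
    rw [← integralModel_Δ_eq R] at h
    by_contra hcon
    exact absurd h (ne_of_lt ((HeightOneSpectrum.valuation_lt_one_iff_mem _ _).2
      ((IsLocalRing.mem_maximalIdeal _).2 hcon)))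
  obtain ⟨D', hD'⟩ := exists_integral_variableChange h6 W₀ _ hW₀ hΔ _ key
  have hred : (W.minimal R).reduction R =
      D'.map (IsLocalRing.residue R) • W₀.map (IsLocalRing.residue R) := by
    rw [map_variableChange, hD']; rfl
  rw [numReductionPoints, card_affinePoint, hred, card_equation_variableChange]
  rw [reduction, map_Δ]
  exact (hΔ.map (IsLocalRing.residue R)).ne_zero

theorem good_reduction_mordell [Algebra ℚ F] (h6 : IsUnit (6 : R))
    [Finite (IsLocalRing.ResidueField R)] (k k' : ℤ) (c : F) (hc : c ≠ 0)
    (hk : (k : F) = c ^ 6 * (k' : F)) (hk' : IsUnit (k' : R)) :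
    HasGoodReductionAt R ((curve k).baseChange F) ∧
    numReductionPoints R ((curve k).baseChange F) =
      mordellCount (IsLocalRing.ResidueField R) (k' : IsLocalRing.ResidueField R) + 1 := by
  let W₀ : WeierstrassCurve R := ⟨0, 0, 0, 0, (k' : R)⟩
  have hΔ : IsUnit W₀.Δ := by
    have h2 : IsUnit (2 : R) := isUnit_of_dvd_unit ⟨3, by norm_num⟩ h6
    have h3 : IsUnit (3 : R) := isUnit_of_dvd_unit ⟨2, by norm_num⟩ h6
    have : W₀.Δ = -(2 ^ 4 * 3 ^ 3 * (k' : R) ^ 2) := by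
      simp [W₀, WeierstrassCurve.Δ, b₂, b₄, b₆, b₈]; ring
    rw [this]
    exact (((h2.pow 4).mul (h3.pow 3)).mul (hk'.pow 2)).neg
  let C : VariableChange F := ⟨Units.mk0 c hc, 0, 0, 0⟩
  have hC : C • (curve k).baseChange F = W₀.map (algebraMap R F) := by
    ext <;> simp [C, W₀, curve, variableChange_def, baseChange, hk, hc]
  refine ⟨hasGoodReduction_minimal_of_unit_model _ W₀ hΔ C hC, ?_⟩
  rw [numReductionPoints_of_unit_model h6 _ W₀ hΔ C hC, mordellCount]
  congr 1
  refine Nat.card_congr (Equiv.subtypeEquivRight fun P => ?_)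
  rw [WeierstrassCurve.Affine.equation_iff]
  simp [W₀]

theorem unit_discriminant_of_good_reduction (W : WeierstrassCurve F)
    (h : HasGoodReductionAt R W) : ∃ (u : Fˣ) (r : Rˣ), W.Δ = u ^ 12 * algebraMap R F r := by
  obtain ⟨r, hr⟩ := exists_unit_of_valuation_eq_one _ (HasGoodReduction.goodReduction (self := h))
  refine ⟨(W.exists_isMinimal R).choose.u, r, ?_⟩
  rw [hr, minimal, variableChange_Δ, ← mul_assoc, ← mul_pow]
  simp

end GoodModel

/-! ### Rational primes -/

section Rational

variable {p : ℕ} [Fact p.Prime]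

theorem intCast_isUnit_padicInt {n : ℤ} (hn : ¬ (p : ℤ) ∣ n) : IsUnit (n : ℤ_[p]) := by
  rw [PadicInt.isUnit_iff]
  exact le_antisymm (PadicInt.norm_le_one _)
    (not_lt.1 fun h => hn ((PadicInt.norm_int_lt_one_iff_dvd n).1 h))

theorem not_dvd_six_mul_pow (hp5 : 5 ≤ p) {n : ℕ} (hn : n ∣ 6 ^ 4) : ¬ p ∣ n := by
  have hpp : p.Prime := Fact.out
  intro h
  have h6 := hpp.dvd_of_dvd_pow (h.trans hn)
  have := Nat.le_of_dvd (by norm_num) h6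
  interval_cases p
  · omega
  · norm_num at hpp

/-- The discriminant -432k² equals u¹² times a unit, and 432 is prime to p, so 2·v(k) = 12·v(u). -/
theorem exists_sixth_power_factor {k : ℤ} (hk : k ≠ 0) (hp5 : 5 ≤ p) (h : GoodPrime k p) :
    ∃ (n : ℕ) (k' : ℤ), k = p ^ (6 * n) * k' ∧ ¬ (p : ℤ) ∣ k' := by
  have hpp : p.Prime := Fact.out
  obtain ⟨u, r, hur⟩ := unit_discriminant_of_good_reduction _ h
  have hr0 : ((r : ℤ_[p]) : ℚ_[p]) ≠ 0 := by simp
  have hr : ((r : ℤ_[p]) : ℚ_[p]).valuation = 0 := by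
    have h1 : ‖((r : ℤ_[p]) : ℚ_[p])‖ = 1 := PadicInt.norm_units r
    rw [Padic.norm_eq_zpow_neg_valuation hr0,
      zpow_eq_one_iff_right₀ (by positivity) (by exact_mod_cast hpp.one_lt.ne')] at h1
    omega
  have hΔ : ((curve k).baseChange ℚ_[p]).Δ = ((-432 : ℤ) : ℚ_[p]) * ((k : ℤ) : ℚ_[p]) ^ 2 := by
    simp [curve, WeierstrassCurve.Δ, WeierstrassCurve.b₂, WeierstrassCurve.b₄,
      WeierstrassCurve.b₆, WeierstrassCurve.b₈, WeierstrassCurve.baseChange]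
    ring
  have hkF : ((k : ℤ) : ℚ_[p]) ≠ 0 := by exact_mod_cast hk
  have hcast : algebraMap ℤ_[p] ℚ_[p] r = ((r : ℤ_[p]) : ℚ_[p]) := rfl
  rw [hΔ, hcast] at hur
  have hv := congrArg Padic.valuation hur
  have h432 : padicValInt p (-432) = 0 := by
    refine padicValInt.eq_zero_of_not_dvd fun hd => ?_
    rw [dvd_neg] at hd
    exact not_dvd_six_mul_pow hp5 (n := 432) (by norm_num) (by exact_mod_cast hd)
  rw [Padic.valuation_mul (by norm_num) (pow_ne_zero _ hkF),
    Padic.valuation_mul (pow_ne_zero _ u.ne_zero) hr0, Padic.valuation_pow, Padic.valuation_pow,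
    hr, Padic.valuation_intCast, Padic.valuation_intCast, h432] at hv
  obtain ⟨k', hk'⟩ := (padicValInt_dvd_iff (p := p) (padicValInt p k) k).2 (Or.inr le_rfl)
  refine ⟨padicValInt p k / 6, k', ?_, fun hd => ?_⟩
  · have h6 : 6 ∣ padicValInt p k := by omega
    rw [Nat.mul_div_cancel' h6]
    exact hk'
  · have := (padicValInt_dvd_iff (p := p) (padicValInt p k + 1) k).1
      (by rw [pow_succ]; exact (mul_dvd_mul_left _ hd).trans (dvd_of_eq hk'.symm))
    rcases this with h0 | h0
    · exact hk h0
    · omega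

theorem numPoints_eq {k k' : ℤ} {n : ℕ} (hp5 : 5 ≤ p) (hk : k = p ^ (6 * n) * k')
    (hk' : ¬ (p : ℤ) ∣ k') : numPoints k p = mordellCount (ZMod p) (k' : ZMod p) + 1 := by
  have hpp : p.Prime := Fact.out
  have hcard : Nat.card (IsLocalRing.ResidueField ℤ_[p]) = p := by
    rw [Nat.card_congr PadicInt.residueField.toEquiv, Nat.card_zmod]
  have : Finite (IsLocalRing.ResidueField ℤ_[p]) :=
    Nat.finite_of_card_ne_zero (by rw [hcard]; exact hpp.ne_zero)
  have h6 : IsUnit (6 : ℤ_[p]) := by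
    have := intCast_isUnit_padicInt (p := p) (n := 6) fun hd =>
      not_dvd_six_mul_pow hp5 (n := 6) (by norm_num) (by exact_mod_cast hd)
    exact_mod_cast this
  have := (good_reduction_mordell (F := ℚ_[p]) h6 k k' ((p : ℚ_[p]) ^ n)
    (pow_ne_zero _ (by exact_mod_cast hpp.ne_zero)) (by rw [hk]; push_cast; ring)
    (intCast_isUnit_padicInt hk')).2
  rw [numPoints, this, mordellCount_intCast hcard (Nat.card_zmod p)]

end Rational

/-! ### The Eisenstein integers -/

section Eisenstein

theorem one_add_root_add_sq {R : Type*} [CommRing R] [IsDomain R] {w : R}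
    (hw : IsPrimitiveRoot w 3) : 1 + w + w ^ 2 = 0 := by
  have := hw.geom_sum_eq_zero (by norm_num)
  simpa [Finset.sum_range_succ] using this

theorem exists_int_sub_mem {K : Type*} [Field K] [NumberField K]
    {P : Ideal (𝓞 K)} {p : ℕ} (hp : p.Prime) (hP : Ideal.absNorm P = p)
    (x : 𝓞 K) : ∃ n : ℤ, x - n ∈ P := by
  have hprime : P.IsPrime := Ideal.isPrime_of_irreducible_absNorm (hP ▸ hp)
  have hcard : Nat.card (𝓞 K ⧸ P) = p := hP
  have : Finite (𝓞 K ⧸ P) := Nat.finite_of_card_ne_zero (by rw [hcard]; exact hp.ne_zero)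
  have := Fintype.ofFinite (𝓞 K ⧸ P)
  rw [Nat.card_eq_fintype_card] at hcard
  let e := ZMod.ringEquivOfPrime (𝓞 K ⧸ P) hp hcard
  have : Fact p.Prime := ⟨hp⟩
  refine ⟨((e.symm (Ideal.Quotient.mk P x)).val : ℤ), ?_⟩
  rw [← Ideal.Quotient.eq, map_intCast, Int.cast_natCast, ← map_natCast e, ZMod.natCast_val,
    ZMod.cast_id', id, e.apply_symm_apply]

variable (K : Type*) [Field K] [NumberField K] [IsCyclotomicExtension {3} ℚ K]

/-- Complex conjugation on the ring of integers of `ℚ(√-3)`. -/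
noncomputable def conj : 𝓞 K ≃+* 𝓞 K :=
  haveI : IsCMField K :=
    IsCyclotomicExtension.Rat.isCMField K (S := {3}) ⟨3, rfl, by norm_num⟩
  (IsCMField.ringOfIntegersComplexConj K).toRingEquiv

theorem conjIdeal_eq_map (I : Ideal (𝓞 K)) : conjIdeal I = I.map (conj K) := rfl

theorem exists_basis_conj : ∃ w : 𝓞 K, IsPrimitiveRoot w 3 ∧
    (∀ x : 𝓞 K, ∃ a b : ℤ, x = a + b * w) ∧ conj K w = w ^ 2 := by
  have : IsCMField K :=
    IsCyclotomicExtension.Rat.isCMField K (S := {3}) ⟨3, rfl, by norm_num⟩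
  have hζ := IsCyclotomicExtension.zeta_spec 3 ℚ K
  have hw := hζ.toInteger_isPrimitiveRoot
  refine ⟨hζ.toInteger, hw, fun x => ?_, ?_⟩
  · have hdim : hζ.integralPowerBasis.dim = 2 := by
      rw [IsPrimitiveRoot.integralPowerBasis_dim]; rfl
    obtain ⟨f, hf, hx⟩ := hζ.integralPowerBasis.exists_eq_aeval x
    obtain ⟨b, a, rfl⟩ := Polynomial.exists_eq_X_add_C_of_natDegree_le_one
      (show f.natDegree ≤ 1 by omega)
    refine ⟨a, b, ?_⟩
    rw [hx, IsPrimitiveRoot.integralPowerBasis_gen]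
    simp [add_comm]
  · have hu : IsOfFinOrder (hw.isUnit (by norm_num)).unit := by
      refine isOfFinOrder_iff_pow_eq_one.2 ⟨3, by norm_num, ?_⟩
      ext1
      simpa using hw.pow_eq_one
    -- Complex conjugation inverts roots of unity.
    have h := IsCMField.complexConj_torsion K ⟨_, (CommGroup.mem_torsion _).2 hu⟩
    apply RingOfIntegers.coe_injective
    have h3 : (hζ.toInteger : K) ^ 3 = 1 := by
      rw [← map_pow, hw.pow_eq_one, map_one]
    refine (h.trans ?_)
    rw [IsUnit.unit_spec, map_pow, inv_eq_iff_eq_inv]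
    exact eq_inv_of_mul_eq_one_right (by rw [← pow_succ, h3])

theorem finrank_ringOfIntegers : Module.finrank ℤ (𝓞 K) = 2 := by
  rw [RingOfIntegers.rank, IsCyclotomicExtension.finrank (n := 3) K
    (Polynomial.cyclotomic.irreducible_rat (by norm_num))]
  rfl

theorem trace_eq_add_conj (x : 𝓞 K) : ((Algebra.trace ℤ (𝓞 K) x : ℤ) : 𝓞 K) = x + conj K x := by
  obtain ⟨w, hw, hb, hc⟩ := exists_basis_conj K
  have hsum := one_add_root_add_sq hw
  have hint (n : ℤ) : Algebra.trace ℤ (𝓞 K) (n : 𝓞 K) = 2 * n := by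
    have := Algebra.trace_algebraMap (S := 𝓞 K) n
    rw [finrank_ringOfIntegers K] at this
    simpa using this
  -- The trace is invariant under conjugation, which sends w to -1 - w.
  have htw : Algebra.trace ℤ (𝓞 K) w = -1 := by
    have h := Algebra.trace_eq_of_algEquiv (RingEquiv.toIntAlgEquiv (conj K)) w
    have h' : RingEquiv.toIntAlgEquiv (conj K) w = ((-1 : ℤ) : 𝓞 K) - w := by
      change conj K w = _
      rw [hc]; push_cast; linear_combination hsum
    rw [h', map_sub, hint] at h
    omega
  obtain ⟨a, b, rfl⟩ := hb x
  have : (a + b * w : 𝓞 K) = a + b • w := by simp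
  rw [map_add (conj K), map_mul (conj K), map_intCast (conj K), map_intCast (conj K), hc, this,
    map_add, map_zsmul, hint, htw, smul_eq_mul]
  push_cast
  linear_combination (-(b : 𝓞 K)) * hsum

theorem mul_conj_add_mul {w : 𝓞 K} (hw : IsPrimitiveRoot w 3) (hc : conj K w = w ^ 2) (a b : ℤ) :
    (a + b * w) * conj K (a + b * w) = ((a ^ 2 - a * b + b ^ 2 : ℤ) : 𝓞 K) := by
  rw [map_add, map_mul, map_intCast, map_intCast, hc]
  push_cast
  linear_combination (a * b : 𝓞 K) * one_add_root_add_sq hw + (b : 𝓞 K) ^ 2 * hw.pow_eq_one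

theorem mul_conj_eq_absNorm (x : 𝓞 K) :
    x * conj K x = ((Ideal.absNorm (Ideal.span {x}) : ℕ) : 𝓞 K) := by
  obtain ⟨w, hw, hb, hc⟩ := exists_basis_conj K
  obtain ⟨a, b, hx⟩ := hb x
  have hm : x * conj K x = ((a ^ 2 - a * b + b ^ 2 : ℤ) : 𝓞 K) := by
    rw [hx, mul_conj_add_mul K hw hc]
  have h0 : 0 ≤ a ^ 2 - a * b + b ^ 2 := by nlinarith [sq_nonneg (a - b), sq_nonneg (a + b)]
  have hN : Algebra.norm ℤ (conj K x) = Algebra.norm ℤ x :=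
    Algebra.norm_eq_of_algEquiv (RingEquiv.toIntAlgEquiv (conj K)) x
  have h := congrArg (Algebra.norm ℤ) hm
  have h2 := Algebra.norm_algebraMap (S := 𝓞 K) (a ^ 2 - a * b + b ^ 2)
  rw [finrank_ringOfIntegers K] at h2
  rw [map_mul, hN, ← sq] at h
  have h3 : (Algebra.norm ℤ x) ^ 2 = (a ^ 2 - a * b + b ^ 2) ^ 2 := h.trans h2
  have h4 : ((Ideal.absNorm (Ideal.span {x}) : ℕ) : ℤ) = a ^ 2 - a * b + b ^ 2 := by
    rw [Ideal.absNorm_span_singleton, Int.natCast_natAbs, ← abs_of_nonneg h0]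
    exact (sq_eq_sq_iff_abs_eq_abs _ _).1 h3
  rw [hm, ← h4, Int.cast_natCast]

variable {K}

theorem conjIdeal_span (x : 𝓞 K) : conjIdeal (Ideal.span {x}) = Ideal.span {conj K x} := by
  rw [conjIdeal_eq_map, Ideal.map_span, Set.image_singleton]

theorem conj_mem_conjIdeal {I : Ideal (𝓞 K)} {x : 𝓞 K} (hx : x ∈ I) :
    conj K x ∈ conjIdeal I := Ideal.mem_map_of_mem (conj K) hx

theorem absNorm_conjIdeal (I : Ideal (𝓞 K)) : Ideal.absNorm (conjIdeal I) = Ideal.absNorm I := by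
  rw [Ideal.absNorm_apply, Ideal.absNorm_apply, Submodule.cardQuot_apply, Submodule.cardQuot_apply]
  exact (Nat.card_congr (Ideal.quotientEquiv I (conjIdeal I) (conj K) rfl).toEquiv).symm

theorem span_mul_conjIdeal_span (x : 𝓞 K) : Ideal.span {x} * conjIdeal (Ideal.span {x}) =
    Ideal.span {((Ideal.absNorm (Ideal.span {x}) : ℕ) : 𝓞 K)} := by
  rw [conjIdeal_span, Ideal.span_singleton_mul_span_singleton, mul_conj_eq_absNorm]

theorem absNorm_eq_of_span_eq_mul_conjIdeal {P : Ideal (𝓞 K)} {p : ℕ}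
    (h : Ideal.span {(p : 𝓞 K)} = P * conjIdeal P) : Ideal.absNorm P = p := by
  have h1 := congrArg Ideal.absNorm h
  rw [Ideal.absNorm_span_natCast, finrank_ringOfIntegers, map_mul, absNorm_conjIdeal, ← sq] at h1
  exact (Nat.pow_left_injective (n := 2) (by norm_num) h1).symm

/-- The residue field is a prime field, so w ≡ n for an integer n. If P were stable under
conjugation, w² ≡ n as well, so P would contain w - w², whose square is -3. -/
theorem ne_conjIdeal_of_absNorm {P : Ideal (𝓞 K)} {p : ℕ} (hp : p.Prime) (hp3 : p ≠ 3)
    (hP : Ideal.absNorm P = p) : P ≠ conjIdeal P := by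
  intro h
  have hprime : P.IsPrime := Ideal.isPrime_of_irreducible_absNorm (hP ▸ hp)
  obtain ⟨w, hw, hb, hc⟩ := exists_basis_conj K
  have hsum := one_add_root_add_sq hw
  obtain ⟨n, hn⟩ := exists_int_sub_mem hp hP w
  have hn' := conj_mem_conjIdeal hn
  rw [← h, map_sub, map_intCast, hc] at hn'
  have h1 : w - w ^ 2 ∈ P := by
    have := P.sub_mem hn hn'
    rwa [sub_sub_sub_cancel_right] at this
  have h3 : ((3 : ℤ) : 𝓞 K) ∈ P := by
    have := P.mul_mem_left (-(w - w ^ 2)) h1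
    convert this using 1
    push_cast
    linear_combination (w ^ 2 - 3 * w + 3) * hsum
  have hpP : ((p : ℤ) : 𝓞 K) ∈ P := by
    have := Ideal.absNorm_mem P
    rw [hP] at this
    exact_mod_cast this
  obtain ⟨a, b, hab⟩ : IsCoprime (3 : ℤ) p := by
    have := (Nat.coprime_primes Nat.prime_three hp).2 hp3.symm
    exact_mod_cast Nat.isCoprime_iff_coprime.2 this
  refine hprime.ne_top ((Ideal.eq_top_iff_one P).2 ?_)
  have := P.add_mem (P.mul_mem_left (a : 𝓞 K) h3) (P.mul_mem_left (b : 𝓞 K) hpP)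
  rw [← Int.cast_mul, ← Int.cast_mul, ← Int.cast_add, hab, Int.cast_one] at this
  exact this

theorem isUnit_mul_conj {u : 𝓞 K} (hu : IsUnit u) : u * conj K u = 1 := by
  rw [mul_conj_eq_absNorm, Ideal.span_singleton_eq_top.2 hu, Ideal.absNorm_top, Nat.cast_one]

/-- With u = A + Bw, a unit satisfies (2A - B)² + 3B² = 4. As 3 ∣ B, this gives B = 0 and A = ±1,
and A ≡ 1 (mod 3) fixes the sign. -/
theorem eq_one_of_isUnit_of_sub_one_mem {u : 𝓞 K} (hu : IsUnit u)
    (h : u - 1 ∈ Ideal.span {(3 : 𝓞 K)}) : u = 1 := by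
  obtain ⟨w, hw, hb, hc⟩ := exists_basis_conj K
  obtain ⟨x, hx⟩ := Ideal.mem_span_singleton'.1 h
  obtain ⟨a, b, rfl⟩ := hb x
  have hu1 := isUnit_mul_conj hu
  have hu2 : u = ((1 + 3 * a : ℤ) : 𝓞 K) + ((3 * b : ℤ) : 𝓞 K) * w := by
    push_cast; linear_combination -hx
  rw [hu2, mul_conj_add_mul K hw hc] at hu1
  have h1 : (1 + 3 * a) ^ 2 - (1 + 3 * a) * (3 * b) + (3 * b) ^ 2 = 1 := by exact_mod_cast hu1
  have hb0 : b = 0 := by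
    by_contra hb0
    have : 1 ≤ b ^ 2 := Int.one_le_abs hb0 |> fun h => by nlinarith [sq_abs b, abs_nonneg b]
    nlinarith [sq_nonneg (2 * (1 + 3 * a) - 3 * b)]
  have ha0 : a = 0 := by
    subst hb0
    have : a * (2 + 3 * a) = 0 := by nlinarith
    rcases mul_eq_zero.1 this with h | h
    · exact h
    · omega
  rw [hu2, ha0, hb0]; simp

end Eisenstein

/-! ### Power residue characters and Jacobi sums -/

section Characters

/-- Substitute b = -cx. -/
theorem sum_apply_mul_apply_add {F : Type*} [Field F] [Fintype F] {D : Type*} [CommRing D]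
    (ψ ρ : MulChar F D) (hψ : ψ (-1) = 1) {c : F} (hc : c ≠ 0) :
    ∑ b, ψ b * ρ (b + c) = ψ c * ρ c * jacobiSum ψ ρ := by
  rw [jacobiSum, Finset.mul_sum,
    ← Equiv.sum_comp (Equiv.mulLeft₀ (-c) (neg_ne_zero.2 hc)) (fun b => ψ b * ρ (b + c))]
  refine Finset.sum_congr rfl fun x _ => ?_
  simp only [Equiv.mulLeft₀_apply]
  rw [show -c * x + c = c * (1 - x) by ring, show -c * x = -1 * c * x by ring]
  simp only [map_mul, hψ]
  ring

variable {F : Type*} [Field F] [Fintype F] {D : Type*} [CommRing D] [IsDomain D]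

theorem exists_pow_eq_of_pow_card_div {d m : ℕ} (hd : d * m = Fintype.card F - 1) {b : F}
    (hb : b ≠ 0) (h : b ^ m = 1) : ∃ a, a ^ d = b := by
  classical
  have hpos : 0 < Fintype.card F - 1 := by have := Fintype.one_lt_card (α := F); omega
  have hm : 0 < m := Nat.pos_of_ne_zero fun h0 => by simp [h0] at hd; omega
  obtain ⟨g, hg⟩ := IsCyclic.exists_generator (α := Fˣ)
  obtain ⟨n, hn⟩ := (mem_powers_iff_mem_zpowers (x := g) (y := Units.mk0 b hb)).2 (hg _)
  have hn' : g ^ n = Units.mk0 b hb := hn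
  have ho : orderOf g = d * m := by
    rw [orderOf_eq_card_of_forall_mem_zpowers hg, Nat.card_eq_fintype_card, Fintype.card_units, hd]
  have h1 : g ^ (n * m) = 1 := by
    rw [pow_mul, hn']; ext; simpa using h
  rw [← orderOf_dvd_iff_pow_eq_one, ho] at h1
  obtain ⟨e, rfl⟩ := Nat.dvd_of_mul_dvd_mul_right hm h1
  refine ⟨(g ^ e : Fˣ), ?_⟩
  rw [← Units.val_pow_eq_pow_val, ← pow_mul, mul_comm, hn', Units.val_mk0]

theorem card_filter_pow_eq [DecidableEq F] {d m : ℕ} (hd : d * m = Fintype.card F - 1)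
    (ψ : MulChar F D) (hψ : ψ ^ d = 1) (hψ1 : ∀ x, x ≠ 0 → ψ x = 1 → x ^ m = 1) (b : F) :
    (((Finset.univ.filter fun x : F => x ^ d = b).card : ℕ) : D) =
      ∑ i ∈ Finset.range d, ψ b ^ i := by
  have hpos : 0 < Fintype.card F - 1 := by have := Fintype.one_lt_card (α := F); omega
  have hd0 : 0 < d := Nat.pos_of_ne_zero fun h0 => by simp [h0] at hd; omega
  have hpow (x : F) (hx : x ≠ 0) : ψ x ^ d = 1 := by
    rw [← MulChar.pow_apply' _ hd0.ne', hψ, MulChar.one_apply hx.isUnit]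
  rcases eq_or_ne b 0 with rfl | hb
  · have : (Finset.univ.filter fun x : F => x ^ d = 0) = {0} := by
      ext x; simp [hd0.ne']
    rw [this, Finset.card_singleton, MulChar.map_nonunit _ not_isUnit_zero]
    obtain ⟨e, rfl⟩ := Nat.exists_eq_add_of_lt hd0
    simp [Finset.sum_range_succ']
  by_cases h1 : ψ b = 1
  · obtain ⟨a, ha⟩ := exists_pow_eq_of_pow_card_div hd hb (hψ1 b hb h1)
    have ha0 : a ≠ 0 := by rintro rfl; rw [zero_pow hd0.ne'] at ha; exact hb ha.symm
    have hroot : ∃ z : F, IsPrimitiveRoot z d := by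
      obtain ⟨g, hg⟩ := IsCyclic.exists_generator (α := Fˣ)
      have ho : orderOf g = d * m := by
        rw [orderOf_eq_card_of_forall_mem_zpowers hg, Nat.card_eq_fintype_card,
          Fintype.card_units, hd]
      refine ⟨((g ^ m : Fˣ) : F), IsPrimitiveRoot.coe_units_iff.2 ?_⟩
      exact (IsPrimitiveRoot.orderOf g).pow (by rw [ho, hd]; exact hpos) (by rw [ho, mul_comm])
    obtain ⟨z, hz⟩ := hroot
    have hcard : (Finset.univ.filter fun x : F => x ^ d = b).card = d := by
      have : (Finset.univ.filter fun x : F => x ^ d = b) = (Polynomial.nthRoots d b).toFinset := by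
        ext x; simp [Polynomial.mem_nthRoots hd0]
      rw [this, Multiset.toFinset_card_of_nodup (hz.nthRoots_nodup hb), hz.card_nthRoots,
        if_pos ⟨a, ha⟩]
    rw [hcard, h1]; simp
  · have hempty : (Finset.univ.filter fun x : F => x ^ d = b) = ∅ := by
      rw [Finset.filter_eq_empty_iff]
      rintro x - rfl
      have hx : x ≠ 0 := by rintro rfl; exact hb (zero_pow hd0.ne')
      exact h1 (by rw [map_pow, hpow x hx])
    have hgeom := mul_geom_sum (ψ b) d
    rw [hpow b hb, sub_self] at hgeom
    rw [hempty, Finset.card_empty, Nat.cast_zero,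
      (mul_eq_zero.1 hgeom).resolve_left (sub_ne_zero.2 h1)]

theorem sum_comp_pow {d m : ℕ} (hd : d * m = Fintype.card F - 1)
    (ψ : MulChar F D) (hψ : ψ ^ d = 1) (hψ1 : ∀ x, x ≠ 0 → ψ x = 1 → x ^ m = 1) (f : F → D) :
    ∑ x, f (x ^ d) = ∑ b, (∑ i ∈ Finset.range d, ψ b ^ i) * f b := by
  classical
  rw [← Finset.sum_fiberwise' Finset.univ (fun x : F => x ^ d) f]
  refine Finset.sum_congr rfl fun b _ => ?_
  rw [← card_filter_pow_eq hd ψ hψ hψ1 b, Finset.sum_const, nsmul_eq_mul]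

/-- The duplication formula for Jacobi sums. -/
theorem apply_four_mul_jacobiSum_self {m : ℕ} (hd : 2 * m = Fintype.card F - 1)
    (ρ ψ : MulChar F D) (hρ : ρ ^ 2 = 1) (hρ1 : ∀ x, x ≠ 0 → ρ x = 1 → x ^ m = 1)
    (hψ : ψ ≠ 1) (h2 : (2 : F) ≠ 0) :
    ψ 4 * jacobiSum ψ ψ = jacobiSum ψ ρ := by
  have h1 : ∑ y, ψ (1 - y ^ 2) = jacobiSum ψ ρ := by
    rw [sum_comp_pow hd ρ hρ hρ1 (fun s => ψ (1 - s)), jacobiSum_comm, jacobiSum]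
    simp only [Finset.sum_range_succ, Finset.sum_range_zero, pow_zero, pow_one, zero_add, add_mul,
      one_mul, Finset.sum_add_distrib]
    have h0 : ∑ x, ψ (1 - x) = 0 :=
      (Equiv.sum_comp (Equiv.subLeft (1 : F)) ψ).trans (MulChar.sum_eq_zero_of_ne_one hψ)
    rw [h0, zero_add]
  rw [← h1, jacobiSum, Finset.mul_sum]
  -- With y = 2x - 1 one has 1 - y² = 4x(1 - x).
  let e : F ≃ F :=
    { toFun := fun x => 2 * x - 1
      invFun := fun y => (y + 1) / 2
      left_inv := fun x => by field_simp; ring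
      right_inv := fun x => by field_simp; ring }
  rw [← Equiv.sum_comp e (fun y => ψ (1 - y ^ 2))]
  refine Finset.sum_congr rfl fun x _ => ?_
  rw [← map_mul, ← map_mul]
  congr 1
  simp only [e, Equiv.coe_fn_mk]
  ring

/-- Counting square roots with χ³ leaves ∑ χ³(x³ + c); counting cube roots with χ² turns this into
sums of χ²(b)χ³(b + c) and χ⁴(b)χ³(b + c). Rescaling by c gives J(χ², χ³) and J(χ⁴, χ³), which the
duplication formula rewrites. -/
theorem mordellCount_eq_jacobiSum {m : ℕ} (hm : 6 * m = Fintype.card F - 1) (χ : MulChar F D)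
    (hχ : χ ^ 6 = 1) (hχ1 : ∀ j, j ∣ 6 → ∀ x, x ≠ 0 → χ x ^ j = 1 → x ^ (j * m) = 1)
    (hχ2 : χ ^ 2 ≠ 1) (hχ3 : χ ^ 3 ≠ 1) (hχ4 : χ ^ 4 ≠ 1) (h2 : (2 : F) ≠ 0) {c : F} (hc : c ≠ 0) :
    (mordellCount F c : D) = Fintype.card F +
      χ c ^ 5 * χ 4 ^ 2 * jacobiSum (χ ^ 2) (χ ^ 2) +
      χ c * χ 4 ^ 4 * jacobiSum (χ ^ 4) (χ ^ 4) := by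
  classical
  have hneg : χ (-1) ^ 2 = 1 := by rw [← map_pow]; simp
  have hρ : (χ ^ 3) ^ 2 = 1 := by rw [← pow_mul, hχ]
  have hρ1 : ∀ x, x ≠ 0 → (χ ^ 3) x = 1 → x ^ (3 * m) = 1 := fun x hx h => by
    rw [MulChar.pow_apply' _ (by norm_num)] at h
    exact hχ1 3 (by norm_num) x hx h
  have hω : (χ ^ 2) ^ 3 = 1 := by rw [← pow_mul, hχ]
  have hω1 : ∀ x, x ≠ 0 → (χ ^ 2) x = 1 → x ^ (2 * m) = 1 := fun x hx h => by
    rw [MulChar.pow_apply' _ (by norm_num)] at h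
    exact hχ1 2 (by norm_num) x hx h
  have hcount : (mordellCount F c : D) =
      ∑ x : F, (∑ i ∈ Finset.range 2, (χ ^ 3) (x ^ 3 + c) ^ i) := by
    have : mordellCount F c = ∑ x : F, (Finset.univ.filter fun y : F => y ^ 2 = x ^ 3 + c).card := by
      rw [mordellCount, Nat.card_congr
        ((Equiv.subtypeProdEquivSigmaSubtype (fun x y : F => y ^ 2 = x ^ 3 + c))),
        Nat.card_eq_fintype_card, Fintype.card_sigma]
      exact Finset.sum_congr rfl fun x _ => Fintype.card_subtype _
    rw [this, Nat.cast_sum]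
    exact Finset.sum_congr rfl fun x _ =>
      card_filter_pow_eq (m := 3 * m) (by omega) (χ ^ 3) hρ hρ1 _
  have hJ2 := apply_four_mul_jacobiSum_self (m := 3 * m) (by omega) (χ ^ 3) (χ ^ 2) hρ hρ1 hχ2 h2
  have hJ4 := apply_four_mul_jacobiSum_self (m := 3 * m) (by omega) (χ ^ 3) (χ ^ 4) hρ hρ1 hχ4 h2
  have hS2 := sum_apply_mul_apply_add (χ ^ 2) (χ ^ 3)
    (by rw [MulChar.pow_apply' _ (by norm_num), hneg]) hc
  have hS4 := sum_apply_mul_apply_add (χ ^ 4) (χ ^ 3)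
    (by rw [MulChar.pow_apply' _ (by norm_num), show 4 = 2 * 2 from rfl, pow_mul, hneg, one_pow]) hc
  have hc6 : χ c ^ 6 = 1 := by
    rw [← MulChar.pow_apply' _ (by norm_num), hχ, MulChar.one_apply hc.isUnit]
  have h3 : ∑ x : F, (χ ^ 3) (x ^ 3 + c) =
      ∑ b : F, (χ ^ 2) b * (χ ^ 3) (b + c) + ∑ b : F, (χ ^ 4) b * (χ ^ 3) (b + c) := by
    rw [sum_comp_pow (m := 2 * m) (by omega) (χ ^ 2) hω hω1 (fun b => (χ ^ 3) (b + c))]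
    simp only [Finset.sum_range_succ, Finset.sum_range_zero, pow_zero, pow_one, zero_add, add_mul,
      one_mul, Finset.sum_add_distrib]
    have h0 : ∑ x, (χ ^ 3) (x + c) = 0 :=
      (Equiv.sum_comp (Equiv.addRight c) ⇑(χ ^ 3)).trans (MulChar.sum_eq_zero_of_ne_one hχ3)
    rw [h0, zero_add]
    congr 1
    refine Finset.sum_congr rfl fun b _ => ?_
    rw [MulChar.pow_apply' _ (n := 4) (by norm_num), MulChar.pow_apply' _ (n := 2) (by norm_num)]
    ring
  rw [hcount]
  simp only [Finset.sum_range_succ, Finset.sum_range_zero, pow_zero, pow_one, zero_add,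
    Finset.sum_add_distrib]
  rw [h3, hS2, hS4, ← hJ2, ← hJ4, Finset.sum_const, Finset.card_univ, nsmul_eq_mul, mul_one]
  simp only [MulChar.pow_apply' _ (show (2 : ℕ) ≠ 0 by norm_num),
    MulChar.pow_apply' _ (show (3 : ℕ) ≠ 0 by norm_num),
    MulChar.pow_apply' _ (show (4 : ℕ) ≠ 0 by norm_num)]
  linear_combination (χ c * χ 4 ^ 4 * jacobiSum (χ ^ 4) (χ ^ 4)) * hc6

end Characters

/-! ### The sextic residue character and the normalized generator -/

section SexticCharacter

theorem sum_eval_eq_zero {F : Type*} [Field F] [Fintype F] (f : Polynomial F)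
    (hf : f.natDegree < Fintype.card F - 1) : ∑ x : F, f.eval x = 0 := by
  simp only [Polynomial.eval_eq_sum_range]
  rw [Finset.sum_comm]
  refine Finset.sum_eq_zero fun i hi => ?_
  rw [← Finset.mul_sum, FiniteField.sum_pow_lt_card_sub_one F i
    (by rw [Finset.mem_range] at hi; omega), mul_zero]

theorem eq_of_pow_six_of_sub_mem {K : Type*} [Field K] [NumberField K]
    {P : Ideal (𝓞 K)} {p : ℕ} (hp : p.Prime) (hp5 : 5 ≤ p)
    (hP : Ideal.absNorm P = p) {a b : 𝓞 K} (ha : a ^ 6 = 1) (hb : b ^ 6 = 1) (hab : a - b ∈ P) :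
    a = b := by
  have hcop : (Ideal.absNorm P).Coprime 6 := by
    rw [hP]
    refine (Nat.Prime.coprime_iff_not_dvd hp).2 fun h => ?_
    have : Fact p.Prime := ⟨hp⟩
    exact not_dvd_six_mul_pow hp5 (n := 6) (by norm_num) h
  have hinj := Ideal.rootsOfUnityMapQuot_injective (I := P) 6 (by rw [hP]; exact hp.ne_one) hcop
  let ua : (𝓞 K)ˣ := Units.ofPowEqOne a 6 ha (by norm_num)
  let ub : (𝓞 K)ˣ := Units.ofPowEqOne b 6 hb (by norm_num)
  have h := @hinj ⟨ua, by rw [mem_rootsOfUnity]; ext1; simp [ua]⟩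
    ⟨ub, by rw [mem_rootsOfUnity]; ext1; simp [ub]⟩ (by
      ext1
      simpa [ua, ub] using Ideal.Quotient.eq.2 hab)
  have h2 := congrArg (fun z : rootsOfUnity 6 (𝓞 K) => ((z : (𝓞 K)ˣ) : 𝓞 K)) h
  simpa [ua, ub] using h2

/-- Modulo P the sum becomes ∑ x^(2m)(1 - x)^(2m), of degree 4m < |F| - 1, and power sums of such
low degree vanish. -/
theorem jacobiSum_mem {K : Type*} [Field K]
    {P : Ideal (𝓞 K)} [P.IsMaximal] [Fintype (𝓞 K ⧸ P)] {m : ℕ}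
    (hm : 6 * m = Fintype.card (𝓞 K ⧸ P) - 1) (χ : MulChar (𝓞 K ⧸ P) (𝓞 K))
    (hχ : ∀ x, Ideal.Quotient.mk P (χ x) = x ^ m) : jacobiSum (χ ^ 2) (χ ^ 2) ∈ P := by
  let _ : Field (𝓞 K ⧸ P) := Ideal.Quotient.field P
  have hone := Fintype.one_lt_card (α := 𝓞 K ⧸ P)
  rw [← Ideal.Quotient.eq_zero_iff_mem, jacobiSum, map_sum]
  rw [← sum_eval_eq_zero
    ((Polynomial.X ^ (2 * m) * (1 - Polynomial.X) ^ (2 * m) : Polynomial (𝓞 K ⧸ P)))]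
  · refine Finset.sum_congr rfl fun x _ => ?_
    rw [MulChar.pow_apply' _ (by norm_num), MulChar.pow_apply' _ (by norm_num), map_mul, map_pow,
      map_pow, hχ, hχ]
    simp only [Polynomial.eval_mul, Polynomial.eval_pow, Polynomial.eval_X, Polynomial.eval_sub,
      Polynomial.eval_one]
    ring
  · refine lt_of_le_of_lt (b := 2 * m + 2 * m) ?_ (by omega)
    compute_degree

/-- Otherwise x^(jm) = 1 on the whole unit group, forcing 6m ∣ jm. -/
theorem sextic_character_pow_ne_one {K : Type*} [Field K]
    {P : Ideal (𝓞 K)} [P.IsMaximal] [Fintype (𝓞 K ⧸ P)] {m : ℕ}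
    (hm : 6 * m = Fintype.card (𝓞 K ⧸ P) - 1) (χ : MulChar (𝓞 K ⧸ P) (𝓞 K))
    (hχ : ∀ x, Ideal.Quotient.mk P (χ x) = x ^ m) {j : ℕ} (hj0 : 0 < j) (hj6 : j < 6) :
    χ ^ j ≠ 1 := by
  let _ : Field (𝓞 K ⧸ P) := Ideal.Quotient.field P
  have hone := Fintype.one_lt_card (α := 𝓞 K ⧸ P)
  intro h
  have h1 : ∀ x : (𝓞 K ⧸ P)ˣ, x ^ (j * m) = 1 := fun x => by
    have hx : (χ ^ j) x = 1 := by rw [h, MulChar.one_apply_coe]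
    rw [MulChar.pow_apply_coe] at hx
    have := congrArg (Ideal.Quotient.mk P) hx
    rw [map_pow, hχ, map_one, ← pow_mul, mul_comm m j] at this
    ext1
    simpa using this
  have h2 := (FiniteField.forall_pow_eq_one_iff (𝓞 K ⧸ P) _).1 h1
  rw [← Nat.card_eq_fintype_card] at hm
  rw [← Nat.card_eq_fintype_card] at hone
  have h3 : Nat.card (𝓞 K ⧸ P) - 1 ∣ j * m := by simpa [Nat.card_eq_fintype_card] using h2
  rw [← hm] at h3
  have := Nat.dvd_of_mul_dvd_mul_right (k := m) (by omega) h3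
  have := Nat.le_of_dvd hj0 this
  omega

theorem sexticSymbol_eq {K : Type*} [Field K] [NumberField K]
    {P : Ideal (𝓞 K)} {p : ℕ} (hp : p.Prime) (hp5 : 5 ≤ p)
    (hP : Ideal.absNorm P = p) {a z : 𝓞 K} (hz : z ^ 6 = 1) (hza : z - a ^ ((p - 1) / 6) ∈ P) :
    sexticSymbol a P = z := by
  have h : ∃ ζ : 𝓞 K, ζ ^ 6 = 1 ∧ ζ - a ^ ((Ideal.absNorm P - 1) / 6) ∈ P :=
    ⟨z, hz, by rwa [hP]⟩
  rw [sexticSymbol, dif_pos h]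
  refine eq_of_pow_six_of_sub_mem hp hp5 hP h.choose_spec.1 hz ?_
  have hza' : z - a ^ ((Ideal.absNorm P - 1) / 6) ∈ P := by rwa [hP]
  have := P.sub_mem h.choose_spec.2 hza'
  rwa [sub_sub_sub_cancel_right] at this

variable {K : Type*} [Field K] [NumberField K] [IsCyclotomicExtension {3} ℚ K]

/-- Reduction modulo P is bijective on sixth roots of unity: injective because N(P) is prime to 6,
surjective because -w stays primitive. Compose its inverse with x ↦ x^m. -/
theorem exists_sextic_character {P : Ideal (𝓞 K)} [P.IsMaximal] [Fintype (𝓞 K ⧸ P)] {m : ℕ}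
    (hm : 6 * m = Fintype.card (𝓞 K ⧸ P) - 1) :
    ∃ χ : MulChar (𝓞 K ⧸ P) (𝓞 K), χ ^ 6 = 1 ∧ ∀ x, Ideal.Quotient.mk P (χ x) = x ^ m := by
  classical
  let _ : Field (𝓞 K ⧸ P) := Ideal.Quotient.field P
  have hcard : Ideal.absNorm P = Fintype.card (𝓞 K ⧸ P) := by
    rw [← Nat.card_eq_fintype_card]; rfl
  have hone := Fintype.one_lt_card (α := 𝓞 K ⧸ P)
  have hm0 : m ≠ 0 := by omega
  have hcop : (Ideal.absNorm P).Coprime 6 := by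
    rw [hcard, show Fintype.card (𝓞 K ⧸ P) = 1 + 6 * m by omega]
    simp
  have hinj := Ideal.rootsOfUnityMapQuot_injective (I := P) 6 (by omega) hcop
  obtain ⟨w, hw, -, -⟩ := exists_basis_conj K
  have hprim : IsPrimitiveRoot (-w) 6 := by
    rw [IsPrimitiveRoot.iff_orderOf, ← neg_one_mul,
      (Commute.all (-1 : 𝓞 K) w).orderOf_mul_eq_mul_orderOf_of_coprime] <;>
    rw [orderOf_neg_one, ringChar.eq_zero, if_neg (by norm_num), ← hw.eq_orderOf]
    norm_num
  have hpow (x : (𝓞 K ⧸ P)ˣ) : (x ^ m) ^ 6 = 1 := by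
    rw [← pow_mul, mul_comm, hm, ← Fintype.card_units, pow_card_eq_one]
  let f : rootsOfUnity 6 (𝓞 K) →* rootsOfUnity 6 (𝓞 K ⧸ P) :=
    (Ideal.rootsOfUnityMapQuot P 6).codRestrict _ fun z => by
      rw [mem_rootsOfUnity, ← map_pow]
      have : z ^ 6 = 1 := by ext1; exact z.2
      rw [this, map_one]
  have hbij : Function.Bijective f := by
    refine ⟨fun a b h => hinj (congrArg Subtype.val h), fun y => ?_⟩
    have hy : ((y : (𝓞 K ⧸ P)ˣ) : 𝓞 K ⧸ P) ^ 6 = 1 := by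
      rw [← Units.val_pow_eq_pow_val, (mem_rootsOfUnity _ _).1 y.2, Units.val_one]
    obtain ⟨i, -, hi⟩ := (hprim.idealQuotient_mk (by omega) hcop).eq_pow_of_pow_eq_one hy
    let u : rootsOfUnity 6 (𝓞 K) := ⟨Units.ofPowEqOne (-w) 6 hprim.pow_eq_one (by norm_num),
      by rw [mem_rootsOfUnity]; ext1; simp⟩
    refine ⟨u ^ i, ?_⟩
    ext1
    ext1
    rw [← hi, ← map_pow]
    rfl
  let e := MulEquiv.ofBijective f hbij
  let g : (𝓞 K ⧸ P)ˣ →* rootsOfUnity 6 (𝓞 K ⧸ P) :=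
    (powMonoidHom m).codRestrict _ fun x => hpow x
  let χ : MulChar (𝓞 K ⧸ P) (𝓞 K) :=
    MulChar.ofUnitHom ((rootsOfUnity 6 (𝓞 K)).subtype.comp (e.symm.toMonoidHom.comp g))
  refine ⟨χ, ?_, fun x => ?_⟩
  · refine MulChar.ext fun x => ?_
    rw [MulChar.pow_apply_coe, MulChar.one_apply_coe]
    simp only [χ, MulChar.ofUnitHom_coe]
    have := (e.symm (g x)).2
    rw [mem_rootsOfUnity] at this
    rw [← Units.val_pow_eq_pow_val, Units.val_eq_one]
    exact this
  · by_cases hx : IsUnit x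
    · obtain ⟨u, rfl⟩ := hx
      simp only [χ, MulChar.ofUnitHom_coe]
      have h1 : e (e.symm (g u)) = g u := e.apply_symm_apply _
      have h2 := congrArg (fun z : rootsOfUnity 6 (𝓞 K ⧸ P) => ((z : (𝓞 K ⧸ P)ˣ) : 𝓞 K ⧸ P)) h1
      exact h2
    · rw [MulChar.map_nonunit _ hx, map_zero]
      have : x = 0 := by rwa [isUnit_iff_ne_zero, not_not] at hx
      rw [this, zero_pow hm0]

theorem conj_apply_of_pow_six {z : 𝓞 K} (hz : z ^ 6 = 1) : conj K z = z ^ 5 := by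
  have hu : IsUnit z := IsUnit.of_pow_eq_one hz (by norm_num)
  refine hu.mul_left_cancel ?_
  rw [isUnit_mul_conj hu, ← pow_succ', hz]

theorem conj_jacobiSum {P : Ideal (𝓞 K)} [P.IsMaximal] [Fintype (𝓞 K ⧸ P)]
    (χ : MulChar (𝓞 K ⧸ P) (𝓞 K)) (hχ : χ ^ 6 = 1) :
    conj K (jacobiSum (χ ^ 2) (χ ^ 2)) = jacobiSum (χ ^ 4) (χ ^ 4) := by
  have h : (χ ^ 2).ringHomComp (conj K : 𝓞 K →+* 𝓞 K) = χ ^ 4 := by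
    refine MulChar.ext fun x => ?_
    have hx : χ x ^ 6 = 1 := by
      rw [← MulChar.pow_apply_coe, hχ, MulChar.one_apply_coe]
    rw [MulChar.ringHomComp_apply, MulChar.pow_apply_coe, MulChar.pow_apply_coe, RingHom.coe_coe,
      map_pow, conj_apply_of_pow_six hx]
    linear_combination (χ x ^ 4) * hx
  have := jacobiSum_ringHomComp (χ ^ 2) (χ ^ 2) (conj K : 𝓞 K →+* 𝓞 K)
  rw [h] at this
  rw [this, RingHom.coe_coe]

theorem jacobiSum_mul_conj {P : Ideal (𝓞 K)} [P.IsMaximal] [Fintype (𝓞 K ⧸ P)] {m : ℕ}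
    (hm : 6 * m = Fintype.card (𝓞 K ⧸ P) - 1) (χ : MulChar (𝓞 K ⧸ P) (𝓞 K)) (hχ6 : χ ^ 6 = 1)
    (hχ : ∀ x, Ideal.Quotient.mk P (χ x) = x ^ m) :
    jacobiSum (χ ^ 2) (χ ^ 2) * conj K (jacobiSum (χ ^ 2) (χ ^ 2)) =
      (Fintype.card (𝓞 K ⧸ P) : 𝓞 K) := by
  let _ : Field (𝓞 K ⧸ P) := Ideal.Quotient.field P
  have hinj : Function.Injective (algebraMap (𝓞 K) K) := RingOfIntegers.coe_injective
  have h2 := sextic_character_pow_ne_one hm χ hχ (j := 2) (by norm_num) (by norm_num)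
  have h4 := sextic_character_pow_ne_one hm χ hχ (j := 4) (by norm_num) (by norm_num)
  set ψ := (χ ^ 2).ringHomComp (algebraMap (𝓞 K) K) with hψ
  have hψ1 : ψ ≠ 1 := (MulChar.ringHomComp_ne_one_iff hinj).2 h2
  have hψ2 : ψ * ψ ≠ 1 := by
    rw [hψ, ← MulChar.ringHomComp_mul, ← pow_add]
    exact (MulChar.ringHomComp_ne_one_iff hinj).2 h4
  have hchar : ringChar K ≠ ringChar (𝓞 K ⧸ P) := by
    rw [ringChar.eq_zero]
    exact (CharP.ringChar_ne_zero_of_finite (𝓞 K ⧸ P)).symm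
  -- This requires ψ and ψ² to be nontrivial; the inverse of χ² is χ⁴, its conjugate.
  have h := jacobiSum_mul_jacobiSum_inv hchar hψ1 hψ1 hψ2
  have hψinv : ψ⁻¹ = (χ ^ 4).ringHomComp (algebraMap (𝓞 K) K) := by
    refine inv_eq_of_mul_eq_one_right ?_
    rw [hψ, ← MulChar.ringHomComp_mul, ← pow_add, hχ6, MulChar.ringHomComp_one]
  rw [hψinv, hψ, jacobiSum_ringHomComp, jacobiSum_ringHomComp, ← map_mul] at h
  rw [conj_jacobiSum χ hχ6]
  exact hinj (by rw [h, map_natCast])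

/-- The number of points on `y² = x³ + c` over a prime field with `p ≡ 1 (mod 3)` elements, in
terms of a generator of a prime ideal above `p` normalized modulo `3`. -/
theorem exists_generator_mordellCount {P : Ideal (𝓞 K)} {p : ℕ} [Fact p.Prime] (hp5 : 5 ≤ p)
    (hp3 : p % 3 = 1) (hP : Ideal.absNorm P = p) {c : ℤ} (hc : ¬ (p : ℤ) ∣ c) :
    ∃ α : 𝓞 K, Ideal.span {α} = P ∧
      (mordellCount (ZMod p) (c : ZMod p) : ℤ) = p - Algebra.trace ℤ (𝓞 K) α ∧
      sexticSymbol (4 * (c : 𝓞 K)) P ^ 6 = 1 ∧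
      α * sexticSymbol (4 * (c : 𝓞 K)) P - 1 ∈ Ideal.span {(3 : 𝓞 K)} := by
  have hp : p.Prime := Fact.out
  have hprime : P.IsPrime := Ideal.isPrime_of_irreducible_absNorm (hP ▸ hp)
  have hne : P ≠ ⊥ := by
    rintro rfl
    rw [Ideal.absNorm_bot] at hP
    exact hp.ne_zero hP.symm
  have hmax : P.IsMaximal := hprime.isMaximal hne
  have hcardP : Nat.card (𝓞 K ⧸ P) = p := hP
  have : Finite (𝓞 K ⧸ P) := Nat.finite_of_card_ne_zero (by rw [hcardP]; exact hp.ne_zero)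
  have := Fintype.ofFinite (𝓞 K ⧸ P)
  let _ : Field (𝓞 K ⧸ P) := Ideal.Quotient.field P
  have hcard : Fintype.card (𝓞 K ⧸ P) = p := by rw [← Nat.card_eq_fintype_card, hcardP]
  have hodd : p % 2 = 1 := (hp.eq_two_or_odd).resolve_left (by omega)
  set m := (p - 1) / 6 with hmdef
  have hm : 6 * m = Fintype.card (𝓞 K ⧸ P) - 1 := by rw [hcard]; omega
  obtain ⟨χ, hχ6, hχ⟩ := exists_sextic_character hm
  have hmem (n : ℤ) : (n : 𝓞 K ⧸ P) = 0 ↔ (p : ℤ) ∣ n := by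
    have : CharP (𝓞 K ⧸ P) p := by
      have e := ZMod.ringEquivOfPrime (𝓞 K ⧸ P) hp hcard
      exact charP_of_injective_ringHom (f := e.toRingHom) e.injective p
    exact CharP.intCast_eq_zero_iff _ p n
  have hc0 : (c : 𝓞 K ⧸ P) ≠ 0 := fun h => hc ((hmem c).1 h)
  have h20 : (2 : 𝓞 K ⧸ P) ≠ 0 := fun h => by
    have := (hmem 2).1 (by exact_mod_cast h)
    exact not_dvd_six_mul_pow hp5 (n := 2) (by norm_num) (by exact_mod_cast this)
  have hpow (x : 𝓞 K ⧸ P) (hx : x ≠ 0) : χ x ^ 6 = 1 := by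
    rw [← MulChar.pow_apply' _ (by norm_num), hχ6, MulChar.one_apply hx.isUnit]
  have hχ1 : ∀ j, j ∣ 6 → ∀ x, x ≠ 0 → χ x ^ j = 1 → x ^ (j * m) = 1 := fun j _ x _ h => by
    have := congrArg (Ideal.Quotient.mk P) h
    rwa [map_pow, hχ, map_one, ← pow_mul, mul_comm m j] at this
  have h4 : (4 : 𝓞 K ⧸ P) = 2 ^ 2 := by norm_num
  have h40 : (4 : 𝓞 K ⧸ P) ≠ 0 := by rw [h4]; exact pow_ne_zero _ h20
  -- 4 is a square, so its sextic symbol is a cube root of unity.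
  have hχ43 : χ 4 ^ 3 = 1 := by rw [h4, map_pow, ← pow_mul, hpow 2 h20]
  have hcount := mordellCount_eq_jacobiSum hm χ hχ6 hχ1
    (sextic_character_pow_ne_one hm χ hχ (by norm_num) (by norm_num))
    (sextic_character_pow_ne_one hm χ hχ (by norm_num) (by norm_num))
    (sextic_character_pow_ne_one hm χ hχ (by norm_num) (by norm_num)) h20 hc0
  have hJP := jacobiSum_mem hm χ hχ
  have hJJ := jacobiSum_mul_conj hm χ hχ6 hχ
  have hJconj := conj_jacobiSum χ hχ6
  obtain ⟨w, hw, -, -⟩ := exists_basis_conj K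
  -- J = -1 + z(w - 1)² with (w - 1)² = -3w, hence J ≡ -1 (mod 3).
  obtain ⟨z, -, hz⟩ := exists_jacobiSum_eq_neg_one_add (n := 3) (by norm_num) (χ := χ ^ 2)
    (ψ := χ ^ 2) (by rw [← pow_mul, hχ6]) (by rw [← pow_mul, hχ6]) (by rw [← hm]; omega) hw
  have hsum := one_add_root_add_sq hw
  set J := jacobiSum (χ ^ 2) (χ ^ 2)
  set s := χ (c : 𝓞 K ⧸ P)
  set t := χ (4 : 𝓞 K ⧸ P)
  have hs : s ^ 6 = 1 := hpow _ hc0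
  have ht : t ^ 6 = 1 := hpow _ h40
  have hsym : sexticSymbol (4 * (c : 𝓞 K)) P = t * s := by
    refine sexticSymbol_eq hp hp5 hP (by rw [mul_pow, hs, ht, one_mul]) ?_
    rw [← Ideal.Quotient.eq, map_mul, hχ, hχ, map_pow, map_mul, map_ofNat, map_intCast, mul_pow]
  have hα : conj K (-(s ^ 5 * t ^ 2 * J)) = -(s * t ^ 4 * jacobiSum (χ ^ 4) (χ ^ 4)) := by
    rw [map_neg, map_mul, map_mul, map_pow, map_pow, conj_apply_of_pow_six hs,
      conj_apply_of_pow_six ht, hJconj]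
    have h1 : (s ^ 5) ^ 5 = s := by
      linear_combination (s ^ 19 + s ^ 13 + s ^ 7 + s) * hs
    have h2 : (t ^ 5) ^ 2 = t ^ 4 := by linear_combination t ^ 4 * ht
    rw [h1, h2]
  have hnorm : Ideal.absNorm (Ideal.span {-(s ^ 5 * t ^ 2 * J)}) = p := by
    have h1 := mul_conj_eq_absNorm K (-(s ^ 5 * t ^ 2 * J))
    rw [hα, ← hJconj] at h1
    have h2 : ((Ideal.absNorm (Ideal.span {-(s ^ 5 * t ^ 2 * J)}) : ℕ) : 𝓞 K) = (p : 𝓞 K) := by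
      rw [← h1, ← hcard, ← hJJ]
      linear_combination (J * conj K J) * (t ^ 6 * hs + ht)
    exact_mod_cast h2
  -- The generator is minus one Jacobi sum term of the count; the other term is its conjugate, so
  -- together they give the trace. Multiplying by ts leaves -J.
  refine ⟨-(s ^ 5 * t ^ 2 * J), ?_, ?_, ?_, ?_⟩
  · have hle : Ideal.span {-(s ^ 5 * t ^ 2 * J)} ≤ P := by
      rw [Ideal.span_singleton_le_iff_mem]
      exact P.neg_mem (P.mul_mem_left _ hJP)
    obtain ⟨Q, hQ⟩ := Ideal.dvd_iff_le.2 hle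
    have h1 := congrArg Ideal.absNorm hQ
    rw [map_mul, hnorm, hP] at h1
    have hQ1 : Ideal.absNorm Q = 1 := by
      have := hp.pos
      nlinarith
    rw [Ideal.absNorm_eq_one_iff] at hQ1
    rw [hQ, hQ1, Ideal.mul_top]
  · rw [mordellCount_intCast (L' := 𝓞 K ⧸ P) (Nat.card_zmod p) hcardP c]
    have h1 := trace_eq_add_conj K (-(s ^ 5 * t ^ 2 * J))
    rw [hα] at h1
    have h2 : (((mordellCount (𝓞 K ⧸ P) (c : 𝓞 K ⧸ P) : ℕ) : ℤ) : 𝓞 K) =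
        ((p - Algebra.trace ℤ (𝓞 K) (-(s ^ 5 * t ^ 2 * J)) : ℤ) : 𝓞 K) := by
      rw [Int.cast_sub, h1, Int.cast_natCast, Int.cast_natCast, hcount, hcard]
      ring
    exact_mod_cast h2
  · rw [hsym, mul_pow, hs, ht, one_mul]
  · rw [hsym, Ideal.mem_span_singleton']
    refine ⟨z * w, ?_⟩
    linear_combination J * (t ^ 3 * hs + hχ43) + hz + z * hsum

end SexticCharacter

/-! ### Values of the Grössencharacter at primes of degree one -/

section GrossencharacterValue

theorem card_residueField_valuationSubring {R : Type*} [CommRing R] [IsDedekindDomain R]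
    {K : Type*} [Field K] [Algebra R K] [IsFractionRing R K] (v : HeightOneSpectrum R) :
    Nat.card (IsLocalRing.ResidueField (v.valuation K).valuationSubring) =
      Nat.card (R ⧸ v.asIdeal) := by
  rw [← HeightOneSpectrum.valuationSubringAtPrime_eq_valuationSubring]
  have : v.asIdeal.IsMaximal := v.isMaximal
  exact (Nat.card_congr (IsLocalization.AtPrime.equivQuotMaximalIdeal v.asIdeal
    (HeightOneSpectrum.valuationSubringAtPrime K v)).toEquiv).symm

variable {K : Type*} [Field K] [NumberField K]

theorem isCoprime_intCast_of_not_dvd {p : ℕ} (hp : p.Prime) {n : ℤ} (hn : ¬ (p : ℤ) ∣ n) :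
    IsCoprime (p : ℤ) n :=
  (Prime.coprime_iff_not_dvd (Nat.prime_iff_prime_int.1 hp)).2 hn

theorem intCast_mem_iff {P : Ideal (𝓞 K)} {p : ℕ} (hp : p.Prime) (hP : Ideal.absNorm P = p)
    (n : ℤ) : (n : 𝓞 K) ∈ P ↔ (p : ℤ) ∣ n := by
  have hpP : ((p : ℤ) : 𝓞 K) ∈ P := by
    have := Ideal.absNorm_mem P
    rw [hP] at this
    exact_mod_cast this
  refine ⟨fun h => ?_, fun ⟨c, hc⟩ => ?_⟩
  · by_contra hn
    obtain ⟨a, b, hab⟩ := isCoprime_intCast_of_not_dvd hp hn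
    have h1 := P.add_mem (P.mul_mem_left (a : 𝓞 K) hpP) (P.mul_mem_left (b : 𝓞 K) h)
    rw [← Int.cast_mul, ← Int.cast_mul, ← Int.cast_add, hab, Int.cast_one,
      ← Ideal.eq_top_iff_one] at h1
    rw [h1, Ideal.absNorm_top] at hP
    exact hp.ne_one hP.symm
  · rw [hc, Int.cast_mul]
    exact P.mul_mem_right _ hpP

theorem isUnit_intCast_valuationSubring (v : HeightOneSpectrum (𝓞 K)) {n : ℤ}
    (hn : (n : 𝓞 K) ∉ v.asIdeal) : IsUnit (n : (v.valuation K).valuationSubring) := by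
  have h1 : v.valuation K (n : K) = 1 := by
    have h := v.valuation_le_one (K := K) (n : 𝓞 K)
    have h' := (v.valuation_lt_one_iff_mem (K := K) (n : 𝓞 K)).not.2 hn
    have hcast : algebraMap (𝓞 K) K (n : 𝓞 K) = n := map_intCast (algebraMap (𝓞 K) K) n
    have hval := congrArg (v.valuation K) hcast
    exact le_antisymm (hval.symm.trans_le h) (not_lt.1 fun hlt => h' (hval.trans_lt hlt))
  have hn0 : (n : K) ≠ 0 := fun h0 => by simp [h0] at h1
  refine IsUnit.of_mul_eq_one ⟨(n : K)⁻¹, ?_⟩ ?_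
  · rw [Valuation.mem_valuationSubring_iff, map_inv₀, h1, inv_one]
  · ext
    simp [hn0]

theorem numReductionPoints_valuationSubring {v : HeightOneSpectrum (𝓞 K)} {p : ℕ} [Fact p.Prime]
    (hp5 : 5 ≤ p) (hP : Ideal.absNorm v.asIdeal = p) {k k' : ℤ} {n : ℕ}
    (hk : k = p ^ (6 * n) * k') (hk' : ¬ (p : ℤ) ∣ k') :
    HasGoodReductionAt (v.valuation K).valuationSubring ((curve k).baseChange K) ∧
    numReductionPoints (v.valuation K).valuationSubring ((curve k).baseChange K) =
      mordellCount (ZMod p) (k' : ZMod p) + 1 := by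
  have hp : p.Prime := Fact.out
  have hcard : Nat.card (IsLocalRing.ResidueField (v.valuation K).valuationSubring) = p := by
    rw [card_residueField_valuationSubring]; exact hP
  have : Finite (IsLocalRing.ResidueField (v.valuation K).valuationSubring) :=
    Nat.finite_of_card_ne_zero (by rw [hcard]; exact hp.ne_zero)
  have h6 : IsUnit (6 : (v.valuation K).valuationSubring) := by
    have := isUnit_intCast_valuationSubring v (n := 6) fun h =>
      not_dvd_six_mul_pow hp5 (n := 6) (by norm_num)
        (by exact_mod_cast (intCast_mem_iff hp hP 6).1 h)
    exact_mod_cast this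
  have h := good_reduction_mordell (F := K) h6 k k' ((p : K) ^ n)
    (pow_ne_zero _ (by exact_mod_cast hp.ne_zero)) (by rw [hk]; push_cast; ring)
    (isUnit_intCast_valuationSubring v fun h => hk' ((intCast_mem_iff hp hP k').1 h))
  exact ⟨h.1, by rw [h.2, mordellCount_intCast hcard (Nat.card_zmod p)]⟩

theorem grossencharacter_of_isPrime {K : Type*} [Field K] [NumberField K] (k : ℤ)
    {P : Ideal (𝓞 K)} (hP : P.IsPrime) (hP0 : P ≠ ⊥) :
    grossencharacter k P = grossencharacterAtPrime k ⟨P, hP, hP0⟩ := by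
  rw [grossencharacter, if_neg hP0, UniqueFactorizationMonoid.normalizedFactors_irreducible
    (Ideal.prime_of_isPrime hP0 hP).irreducible, normalize_eq, Multiset.map_singleton,
    Multiset.prod_singleton, dif_pos ⟨hP, hP0⟩]

variable [IsCyclotomicExtension {3} ℚ K]

/-- Equal trace and norm make β a root of (X - α)(X - ᾱ); β = ᾱ would give P = P̄. -/
theorem generator_eq_of_trace_eq {P : Ideal (𝓞 K)} {p : ℕ} (hp : p.Prime) (hp3 : p ≠ 3)
    (hP : Ideal.absNorm P = p) {α β : 𝓞 K} (hα : Ideal.span {α} = P) (hβ : Ideal.span {β} = P)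
    (h : Algebra.trace ℤ (𝓞 K) α = Algebra.trace ℤ (𝓞 K) β) : α = β := by
  have h1 := trace_eq_add_conj K α
  have h2 := trace_eq_add_conj K β
  have h3 := mul_conj_eq_absNorm K α
  have h4 := mul_conj_eq_absNorm K β
  rw [h, h2] at h1
  rw [hα, ← hβ, ← h4] at h3
  have h5 : (β - α) * (β - conj K α) = 0 := by
    linear_combination β * h1 + h3
  rcases mul_eq_zero.1 h5 with h6 | h6
  · exact (sub_eq_zero.1 h6).symm
  · refine absurd ?_ (ne_conjIdeal_of_absNorm hp hp3 hP)
    rw [← hα, conjIdeal_span, hα, ← hβ, sub_eq_zero.1 h6]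

/-- The value of the Grössencharacter of `y² = x³ + k` at a prime of degree one. -/
theorem grossencharacter_spec {P : Ideal (𝓞 K)} {p : ℕ} [Fact p.Prime] (hp5 : 5 ≤ p)
    (hp3 : p % 3 = 1) (hP : Ideal.absNorm P = p) {k k' : ℤ} {n : ℕ}
    (hk : k = p ^ (6 * n) * k') (hk' : ¬ (p : ℤ) ∣ k') :
    Ideal.span {grossencharacter k P} = P ∧
      (mordellCount (ZMod p) (k' : ZMod p) : ℤ) =
        p - Algebra.trace ℤ (𝓞 K) (grossencharacter k P) ∧
      sexticSymbol (4 * (k' : 𝓞 K)) P ^ 6 = 1 ∧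
      grossencharacter k P * sexticSymbol (4 * (k' : 𝓞 K)) P - 1 ∈ Ideal.span {(3 : 𝓞 K)} := by
  have hp : p.Prime := Fact.out
  have hprime : P.IsPrime := Ideal.isPrime_of_irreducible_absNorm (hP ▸ hp)
  have hP0 : P ≠ ⊥ := by
    rintro rfl
    rw [Ideal.absNorm_bot] at hP
    exact hp.ne_zero hP.symm
  obtain ⟨α, hα, hcount, hsym, hmod⟩ := exists_generator_mordellCount hp5 hp3 hP hk'
  set v : HeightOneSpectrum (𝓞 K) := ⟨P, hprime, hP0⟩ with hv
  have hred := numReductionPoints_valuationSubring (K := K) (v := v) hp5 hP hk hk'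
  have hval : IsGrossencharacterValue k v α := by
    refine ⟨hred.1, hα, ?_⟩
    rw [hred.2, hv]
    push_cast
    rw [hcount, hP]
    ring
  have hex : ∃ α : 𝓞 K, IsGrossencharacterValue k v α := ⟨α, hval⟩
  have hψ : grossencharacter k P = α := by
    rw [grossencharacter_of_isPrime k hprime hP0, grossencharacterAtPrime, dif_pos hex]
    refine generator_eq_of_trace_eq hp (by omega) hP hex.choose_spec.2.1 hα ?_
    have h1 := hex.choose_spec.2.2
    rw [hval.2.2] at h1
    linarith
  rw [hψ]
  exact ⟨hα, hcount, hsym, hmod⟩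

end GrossencharacterValue

/-! ### Splitting of rational primes and norms modulo 3 -/

section Splitting

theorem mordellCount_of_mod_three_eq_two {p : ℕ} [Fact p.Prime] (hp : p % 3 = 2) (c : ZMod p) :
    mordellCount (ZMod p) c = p := by
  have hpp : p.Prime := Fact.out
  obtain ⟨t, ht⟩ : ∃ t, p = 3 * t + 2 := ⟨p / 3, by omega⟩
  -- Here 3(2t + 1) = 2(p - 1) + 1, so raising to the power 2t + 1 inverts cubing.
  have hcube (x : ZMod p) : x ^ (3 * (2 * t + 1)) = x := by
    rw [show 3 * (2 * t + 1) = p + (3 * t + 1) by omega, pow_add, ZMod.pow_card, ← pow_succ',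
      show 3 * t + 1 + 1 = p by omega, ZMod.pow_card]
  let e : {P : ZMod p × ZMod p // P.2 ^ 2 = P.1 ^ 3 + c} ≃ ZMod p :=
    { toFun := fun P => P.1.2
      invFun := fun y => ⟨((y ^ 2 - c) ^ (2 * t + 1), y), by
        rw [← pow_mul, mul_comm _ 3, hcube]; ring⟩
      left_inv := fun ⟨⟨x, y⟩, h⟩ => by
        ext
        · simp only at h ⊢
          rw [h, add_sub_cancel_right, ← pow_mul, hcube]
        · rfl
      right_inv := fun y => rfl }
  rw [mordellCount, Nat.card_congr e, Nat.card_zmod]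

variable (K : Type*) [Field K] [NumberField K] [IsCyclotomicExtension {3} ℚ K]

/-- The inertia degree is the order of p modulo 3, which is 1. -/
theorem exists_prime_absNorm_eq {p : ℕ} [Fact p.Prime] (hp3 : p % 3 = 1) :
    ∃ P : Ideal (𝓞 K), P.IsPrime ∧ Ideal.absNorm P = p := by
  have hp : p.Prime := Fact.out
  have : (Ideal.span {(p : ℤ)}).IsPrime := by
    rw [Ideal.span_singleton_prime (by exact_mod_cast hp.ne_zero)]
    exact Nat.prime_iff_prime_int.1 hp
  obtain ⟨⟨P, hP, hPl⟩⟩ := (inferInstance :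
    Nonempty ((Ideal.span {(p : ℤ)}).primesOver (𝓞 K)))
  refine ⟨P, hP, ?_⟩
  have h1 := IsCyclotomicExtension.Rat.inertiaDeg_eq_of_not_dvd (m := 3) p K P
    (fun h => by
      have := (Nat.prime_dvd_prime_iff_eq hp Nat.prime_three).1 h
      omega)
  have h2 : ((p : ℕ) : ZMod 3) = 1 := by
    rw [← ZMod.natCast_mod, hp3, Nat.cast_one]
  rw [h2, orderOf_one] at h1
  have h3 := Ideal.absNorm_eq_pow_inertiaDeg P (Nat.prime_iff_prime_int.1 hp)
  have hpmax : (Ideal.span {(p : ℤ)}).IsMaximal :=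
    this.isMaximal (by simpa using hp.ne_zero)
  have hPmax : P.IsMaximal := Ideal.IsMaximal.of_liesOver_isMaximal P (Ideal.span {(p : ℤ)})
  rw [Ideal.inertiaDeg'_eq_inertiaDeg, h1, pow_one, Int.natAbs_natCast] at h3
  exact h3

theorem absNorm_span_mod_three (x : 𝓞 K) : Ideal.absNorm (Ideal.span {x}) % 3 ≠ 2 := by
  obtain ⟨w, hw, hb, hc⟩ := exists_basis_conj K
  obtain ⟨a, b, hx⟩ := hb x
  have h := mul_conj_eq_absNorm K x
  rw [hx, mul_conj_add_mul K hw hc] at h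
  have h' : a ^ 2 - a * b + b ^ 2 = (Ideal.absNorm (Ideal.span {x}) : ℕ) := by
    rw [← hx] at h; exact_mod_cast h
  intro h2
  have h3 : ((Ideal.absNorm (Ideal.span {x}) : ℕ) : ℤ) % 3 = 2 := by omega
  rw [← h'] at h3
  rcases (by omega : a % 3 = 0 ∨ a % 3 = 1 ∨ a % 3 = 2) with ha | ha | ha <;>
  rcases (by omega : b % 3 = 0 ∨ b % 3 = 1 ∨ b % 3 = 2) with hb | hb | hb <;>
  simp [pow_two, Int.add_emod, Int.sub_emod, Int.mul_emod, ha, hb] at h3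

end Splitting

/-! ### The congruence for ψ(1 - ψ) modulo 3 -/

section CongruenceModThree

variable {K : Type*} [Field K] [NumberField K] [IsCyclotomicExtension {3} ℚ K]

theorem intCast_notMem_span_three {n : ℤ} (hn : ¬ (3 : ℤ) ∣ n) :
    (n : 𝓞 K) ∉ Ideal.span {(3 : 𝓞 K)} := by
  intro h
  obtain ⟨a, b, hab⟩ := isCoprime_intCast_of_not_dvd Nat.prime_three hn
  have h1 := (Ideal.span {(3 : 𝓞 K)}).add_mem
    ((Ideal.span {(3 : 𝓞 K)}).mul_mem_left (a : 𝓞 K) (Ideal.mem_span_singleton_self 3))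
    ((Ideal.span {(3 : 𝓞 K)}).mul_mem_left (b : 𝓞 K) h)
  have h2 : (a : 𝓞 K) * 3 + b * n = 1 := by exact_mod_cast congrArg (Int.cast : ℤ → 𝓞 K) hab
  rw [h2, ← Ideal.eq_top_iff_one, Ideal.span_singleton_eq_top] at h1
  have h3 := isUnit_mul_conj h1
  rw [map_ofNat] at h3
  norm_num at h3

/-- If `ψ` is a sixth root of unity modulo `3` and `1 - ψ` is prime to `3`, then
`ψ (1 - ψ) ≡ 1 (mod 3)`. -/
theorem mul_one_sub_congr_one {ψ s : 𝓞 K} {q : ℕ} (hq : q.Prime) (hq3 : q ≠ 3)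
    (hψq : (1 - ψ) * conj K (1 - ψ) = q) (hs : s ^ 6 = 1)
    (h : ψ * s - 1 ∈ Ideal.span {(3 : 𝓞 K)}) :
    ψ * (1 - ψ) - 1 ∈ Ideal.span {(3 : 𝓞 K)} := by
  obtain ⟨t, ht⟩ := Ideal.mem_span_singleton'.1 h
  obtain ⟨r, u, hr, hψ⟩ : ∃ r u : 𝓞 K, r ^ 6 = 1 ∧ ψ = r + 3 * u :=
    ⟨s ^ 5, t * s ^ 5, by linear_combination (s ^ 24 + s ^ 18 + s ^ 12 + s ^ 6 + 1) * hs,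
      by linear_combination (-ψ) * hs - s ^ 5 * ht⟩
  have hfac : (r - 1) * (r ^ 2 + r + 1) = 0 ∨ (r + 1) * (r ^ 2 - r + 1) = 0 :=
    mul_eq_zero.1 (by linear_combination hr)
  rcases hfac with h3 | h3
  -- If r³ = 1, then 3 divides (1 - ψ)², since (1 - r)² is 0 or -3r; taking norms, 3 ∣ q².
  · exfalso
    have hsq : ∃ v, (1 - ψ) ^ 2 = 3 * v := by
      rcases mul_eq_zero.1 h3 with h4 | h4
      · exact ⟨3 * u ^ 2, by rw [hψ]; linear_combination (r - 1 + 6 * u) * h4⟩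
      · exact ⟨-r - 2 * (1 - r) * u + 3 * u ^ 2, by rw [hψ]; linear_combination h4⟩
    obtain ⟨v, hv⟩ := hsq
    refine intCast_notMem_span_three (K := K) (n := (q : ℤ) ^ 2) ?_
      (Ideal.mem_span_singleton'.2 ⟨v * conj K (1 - ψ) ^ 2, ?_⟩)
    · intro h5
      have h6 : 3 ∣ q := by
        have := Int.Prime.dvd_pow' Nat.prime_three h5
        exact_mod_cast this
      exact hq3 ((Nat.prime_dvd_prime_iff_eq Nat.prime_three hq).1 h6).symm
    · push_cast
      rw [← hψq]
      linear_combination (-conj K (1 - ψ) ^ 2) * hv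
  -- Either r = -1 and r(1 - r) = -2 ≡ 1, or r is a root of r² - r + 1 and r(1 - r) = 1.
  · rw [Ideal.mem_span_singleton']
    rcases mul_eq_zero.1 h3 with h4 | h4
    · exact ⟨-1 + u - 2 * r * u - 3 * u ^ 2, by rw [hψ]; linear_combination (r - 2) * h4⟩
    · exact ⟨u - 2 * r * u - 3 * u ^ 2, by rw [hψ]; linear_combination h4⟩

end CongruenceModThree

end SexticCM

/-! ### The main theorem -/

theorem theorem19 (K : Type*) [Field K] [NumberField K] [IsCyclotomicExtension {3} ℚ K]
    (k : ℤ) (hk : k ≠ 0) (p q : ℕ) [Fact p.Prime] [Fact q.Prime]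
    (hp5 : 5 ≤ p) (hq5 : 5 ≤ q)
    (hp : SexticCM.GoodPrime k p) (hq : SexticCM.GoodPrime k q)
    (hpq : SexticCM.numPoints k p = q) :
    -- the prime `p` splits in `K`
    (∃ 𝔭 : Ideal (𝓞 K), 𝔭.IsPrime ∧ 𝔭 ≠ SexticCM.conjIdeal 𝔭 ∧
      Ideal.span {(p : 𝓞 K)} = 𝔭 * SexticCM.conjIdeal 𝔭) ∧
    -- for either choice of `𝔭`, and for the ideal `𝔮` generated by `1 - ψ_E(𝔭)`:
    ∀ 𝔭 : Ideal (𝓞 K), 𝔭.IsPrime →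
      Ideal.span {(p : 𝓞 K)} = 𝔭 * SexticCM.conjIdeal 𝔭 →
      ∀ 𝔮 : Ideal (𝓞 K), 𝔮 = Ideal.span {1 - SexticCM.grossencharacter k 𝔭} →
      -- (a)
      SexticCM.grossencharacter k 𝔭 * (1 - SexticCM.grossencharacter k 𝔭) - 1 ∈
        Ideal.span {(3 : 𝓞 K)} ∧
      -- (b)
      (Ideal.span {(q : 𝓞 K)} = 𝔮 * SexticCM.conjIdeal 𝔮 ∧
        𝔮.IsPrime ∧ 𝔮 ≠ SexticCM.conjIdeal 𝔮) ∧
      -- the residue symbols in (c) and (d) are defined when `k` is prime to `p` and `q`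
      (¬ (p : ℤ) ∣ k → ¬ (q : ℤ) ∣ k →
        -- (c)
        1 - SexticCM.grossencharacter k 𝔭 =
          SexticCM.sexticSymbol (4 * (k : 𝓞 K)) 𝔭 * SexticCM.sexticSymbol (4 * (k : 𝓞 K)) 𝔮 *
            SexticCM.grossencharacter k 𝔮 ∧
        -- (d)
        ∀ ε : ℤ, ε = 1 ∨ ε = -1 →
          (SexticCM.frobeniusTrace k q = ε * ((q : ℤ) + 1 - (p : ℤ)) ↔
            SexticCM.sexticSymbol (4 * (k : 𝓞 K)) 𝔭 * SexticCM.sexticSymbol (4 * (k : 𝓞 K)) 𝔮 =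
              (ε : 𝓞 K))) := by
  open SexticCM in
  have hpp : p.Prime := Fact.out
  have hqp : q.Prime := Fact.out
  obtain ⟨n, k', hk', hpk'⟩ := exists_sixth_power_factor hk hp5 hp
  have hnum := numPoints_eq hp5 hk' hpk'
  have hp3 : p % 3 = 1 := by
    have h0 : p % 3 ≠ 0 := fun h =>
      absurd ((Nat.prime_dvd_prime_iff_eq Nat.prime_three hpp).1 (Nat.dvd_of_mod_eq_zero h)) (by omega)
    -- Here the count would be p + 1 = q, impossible for two odd primes.
    have h2 : p % 3 ≠ 2 := fun h => by
      rw [mordellCount_of_mod_three_eq_two h, hpq] at hnum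
      have := hpp.eq_two_or_odd
      have := hqp.eq_two_or_odd
      omega
    omega
  refine ⟨?_, fun 𝔭 _ h𝔭 𝔮 h𝔮 => ?_⟩
  · obtain ⟨P, hP, hPp⟩ := exists_prime_absNorm_eq K hp3
    refine ⟨P, hP, ne_conjIdeal_of_absNorm hpp (by omega) hPp, ?_⟩
    have hspan := (grossencharacter_spec hp5 hp3 hPp hk' hpk').1
    have h := span_mul_conjIdeal_span (grossencharacter k P)
    rw [hspan, hPp] at h
    exact h.symm
  have hPp := absNorm_eq_of_span_eq_mul_conjIdeal h𝔭
  obtain ⟨hspan, hcount, hsym, hmod⟩ := grossencharacter_spec hp5 hp3 hPp hk' hpk'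
  have htr := trace_eq_add_conj K (grossencharacter k 𝔭)
  have hnm := mul_conj_eq_absNorm K (grossencharacter k 𝔭)
  rw [hspan, hPp] at hnm
  have htrace : Algebra.trace ℤ (𝓞 K) (grossencharacter k 𝔭) = p + 1 - q := by
    rw [← hpq, hnum]; push_cast; linarith
  rw [htrace] at htr
  push_cast at htr
  have hψq : (1 - grossencharacter k 𝔭) * conj K (1 - grossencharacter k 𝔭) = q := by
    rw [map_sub, map_one]
    linear_combination hnm + htr
  have h𝔮q : Ideal.absNorm 𝔮 = q := by
    rw [h𝔮]
    have := mul_conj_eq_absNorm K (1 - grossencharacter k 𝔭)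
    rw [hψq] at this
    exact_mod_cast this.symm
  have hcong := mul_one_sub_congr_one hqp (by omega) hψq hsym hmod
  refine ⟨hcong, ⟨?_, Ideal.isPrime_of_irreducible_absNorm (h𝔮q ▸ hqp),
    ne_conjIdeal_of_absNorm hqp (by omega) h𝔮q⟩, fun hpk hqk => ?_⟩
  · have h := span_mul_conjIdeal_span (1 - grossencharacter k 𝔭)
    rw [← h𝔮, h𝔮q] at h
    exact h.symm
  have hq3 : q % 3 = 1 := by
    have h0 : q % 3 ≠ 0 := fun h =>
      absurd ((Nat.prime_dvd_prime_iff_eq Nat.prime_three hqp).1 (Nat.dvd_of_mod_eq_zero h)) (by omega)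
    -- q is a norm from 𝓞 K, and a² - ab + b² is never 2 modulo 3.
    have h2 := absNorm_span_mod_three K (1 - grossencharacter k 𝔭)
    rw [← h𝔮, h𝔮q] at h2
    omega
  obtain ⟨-, -, hSp, hmodp⟩ :=
    -- The symbol is now taken at k itself, whereas (a) and (b) used k' because p may divide k
    -- there.
    grossencharacter_spec (n := 0) hp5 hp3 hPp (show k = p ^ (6 * 0) * k by simp) hpk
  obtain ⟨hspanq, hcountq, hSq, hmodq⟩ :=
    grossencharacter_spec (n := 0) hq5 hq3 h𝔮q (show k = q ^ (6 * 0) * k by simp) hqk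
  have hnumq := numPoints_eq (n := 0) hq5 (show k = q ^ (6 * 0) * k by simp) hqk
  have hab : frobeniusTrace k q = Algebra.trace ℤ (𝓞 K) (grossencharacter k 𝔮) := by
    rw [frobeniusTrace, hnumq]; push_cast; linarith
  have htr1 : Algebra.trace ℤ (𝓞 K) (1 - grossencharacter k 𝔭) = q + 1 - p := by
    have h1 := trace_eq_add_conj K (1 - grossencharacter k 𝔭)
    have h2 : ((Algebra.trace ℤ (𝓞 K) (1 - grossencharacter k 𝔭) : ℤ) : 𝓞 K) =
        ((q + 1 - p : ℤ) : 𝓞 K) := by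
      rw [h1, map_sub, map_one]
      push_cast
      linear_combination htr
    exact_mod_cast h2
  set ψ := grossencharacter k 𝔭
  set φ := grossencharacter k 𝔮 with hφ
  set S := sexticSymbol (4 * (k : 𝓞 K)) 𝔭
  set T := sexticSymbol (4 * (k : 𝓞 K)) 𝔮
  have hφ0 : φ ≠ 0 := fun h0 => by
    rw [h0, Ideal.span_singleton_eq_bot.2 rfl] at hspanq
    rw [← hspanq, Ideal.absNorm_bot] at h𝔮q
    omega
  have hc : 1 - ψ = S * T * φ := by
    obtain ⟨u, hu⟩ := Ideal.span_singleton_eq_span_singleton.1 (hspanq.trans h𝔮)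
    have hST : (S * T) ^ 6 = 1 := by rw [mul_pow, hSp, hSq, one_mul]
    -- Since (ST)⁵ = (ST)⁻¹, this says that u = ST. It suffices to check it modulo 3, where the
    -- three congruences combine.
    have hone : (u : 𝓞 K) * (S * T) ^ 5 = 1 := by
      refine eq_one_of_isUnit_of_sub_one_mem (u.isUnit.mul (IsUnit.pow 5 ?_)) ?_
      · exact (IsUnit.of_pow_eq_one hSp (by norm_num)).mul (IsUnit.of_pow_eq_one hSq (by norm_num))
      · obtain ⟨a, ha⟩ := Ideal.mem_span_singleton'.1 hcong
        obtain ⟨b, hb⟩ := Ideal.mem_span_singleton'.1 hmodp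
        obtain ⟨c, hc⟩ := Ideal.mem_span_singleton'.1 hmodq
        refine Ideal.mem_span_singleton'.2 ⟨(a * (S * T) - u * (b + c + 3 * b * c)) * (S * T) ^ 5, ?_⟩
        linear_combination (-(S * T) ^ 5) * (u * (1 + 3 * b) * hc + u * φ * T * hb +
          ψ * S * T * hu - S * T * ha) - hST
    rw [← hu]
    linear_combination (S * T * φ) * hone - (φ * u) * hST
  refine ⟨hc, fun ε hε => ?_⟩
  have hε2 : ε * ε = 1 := by rcases hε with rfl | rfl <;> norm_num
  have hε2' : (ε : 𝓞 K) * ε = 1 := by exact_mod_cast congrArg (Int.cast : ℤ → 𝓞 K) hε2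
  have htrε : Algebra.trace ℤ (𝓞 K) (ε * (1 - ψ)) = ε * (q + 1 - p) := by
    rw [← zsmul_eq_mul, map_zsmul, htr1, smul_eq_mul]
  rw [hab, ← htrε]
  constructor
  · intro h
    have hspanε : Ideal.span {(ε : 𝓞 K) * (1 - ψ)} = 𝔮 := by
      rw [h𝔮, Ideal.span_singleton_mul_left_unit (IsUnit.of_mul_eq_one _ hε2')]
    -- φ and ε(1 - ψ) generate 𝔮 with equal traces, so they coincide; cancelling φ in (c) leaves ST
    -- = ε.
    have heq := generator_eq_of_trace_eq hqp (by omega) h𝔮q hspanq hspanε h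
    rw [hc] at heq
    refine mul_right_cancel₀ hφ0 ?_
    linear_combination (-(S * T * φ)) * hε2' - (ε : 𝓞 K) * heq
  · intro h
    rw [hc, h, ← mul_assoc, hε2', one_mul]
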